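/- Let $m,n\ge 0$, $N=2n+1$, let $e_{ab}$ be the matrix units of size $2m+N$, and let $J=J(\lambda)=\mathrm{diag}(0_{2m},\,b+\lambda e_{1,N})$ with $b=\sum_{i=1}^{2n}e_{i+1,i}$. Let $C=\mathrm{diag}(\alpha,\beta)$, $\alpha=\sum_{i=1}^{2m}e_{i,2m+1-i}$, $\beta=\sum_{i=1}^{N}(-1)^{n+i-1}e_{i,N+1-i}$, and call a loop $g(\lambda)$ (a matrix with entries in $\mathbb C((\lambda^{-1}))$, possibly depending on $t$) twisted if $g(\lambda)\,C\,g(-\lambda)^{t}C^{-1}=1$. Let $G_-$ be the group of twisted loops $1+\sum_{i<0}g_i\lambda^i$ with determinant $1$, and $G_+$ the group of twisted invertible loops $\sum_{i\ge0}g_i\lambda^i$. All functions of the times $t=(t_1,t_3,t_5,\dots)$ are formal power series in $t$, and $x=t_1$. For $\xi=\sum_i\xi_i\lambda^i$ put $\xi_+=\sum_{i\ge0}\xi_i\lambda^i$. *Tau function.* Let $w(\xi,\eta)=\operatorname{Res}_\lambda\operatorname{tr}(\xi_\lambda\eta)$ (the coefficient of $\lambda^{-1}$), and let $S$ be the natural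 lift of $G_\pm$ to the central extension of the loop group with Lie algebra cocycle $w$. For $f\in G_-$ (independent of $t$) let $W(t)=\exp\bigl(-\sum_{k\ge0}t_{2k+1}J^{2k+1}\bigr)$, $W(t)f^{-1}=M(t)^{-1}E(t)$ with $M(t)\in G_-$, $E(t)\in G_+$; then $\tau_f$ is defined by $S(W)S(f^{-1})=\tau_f\,S(M^{-1})S(E)$. *Hierarchy.* Let $V_{m,n}$ be the space of matrices $u=\sum_{i=1}^m q_i\mu_i+\sum_{i=1}^m r_{m+1-i}\nu_i+\sum_{i=1}^n u_i\omega_i$, where $\mu_i=e_{i,2m+N}+(-1)^{n+1}e_{2m+1,2m+1-i}$, $\nu_i=(-1)^n e_{m+i,2m+N}-e_{2m+1,m+1-i}$, $\omega_i=-e_{2m+n+1-i,2m+n+i}-e_{2m+n+2-i,2m+n+1+i}$. A gauge matrix is $\Delta=\mathrm{diag}(1_{2m},\Delta_{22})$ with $\Delta_{22}$ independent of $\lambda$ and upper triangular with ones on the diagonal. Let $S(u,\lambda)$ be the solution of $[\partial_x+J+u,S]=0$ that is conjugate to $J$ by a product $\Delta g$ of a gauge matrix and some $g\in G_-$, and let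 $S_{2j-1,0}(u)$ be the coefficient of $\lambda^0$ in $S(u,\lambda)^{2j-1}$. The matrix constrained CKP hierarchy is $$u_{t_{2j-1}}=[\partial_x+\mathrm{diag}(0_{2m},b)+u,\;S_{2j-1,0}(u)+\eta_{2j-1}(u)],\qquad j=1,2,\dots,$$ where $\eta_{2j-1}(u)=\mathrm{diag}(0_{2m},\text{strictly upper triangular})$ is such that the right-hand side lies in $V_{m,n}$. *Theorem.* There are differential polynomials $R_1,\dots,R_n$ and $K_1,K_2,\dots$ over $\mathbb C$ (in $x$-derivatives), depending only on $m,n$, such that $R_j$ is a polynomial in $u_1,\dots,u_{j-1}$ and their $x$-derivatives; $K_j$ is a polynomial in the $q_i$, $r_i$, $u_i$ and their $x$-derivatives, in which the derivatives of the $q_i$ and $r_i$ have order at most $2(j-1)$; $K_1$ does not involve the $u_i$; and the following holds. Let $f\in G_-$, with $M$, $E$, $\tau_f$ as above, and let $u$ be the solution of the matrix constrained CKP hierarchy attached to $f$, i.e. $\Delta(\partial_x+(MJM^{-1})_+)\Delta^{-1}=\partial_x+J+u$ for a gauge matrix $\Delta(t)$ and $u(t)\in V_{m,n}$. Then $$(\ln\tau_f)_{t_1t_{2j-1}}=\frac{2(2j-1)}{2n+1}\,u_j+R_j\quad(j=1,\dots,n),\qquad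 (\ln\tau_f)_{t_1t_{2n+2j-1}}=K_j\quad(j=1,2,\dots).$$ -/

import Mathlib

open Matrix

namespace CCKP

noncomputable section

/-! ### Formal functions of the times and formal loops

The times are `t₁, t₃, t₅, …`; the index `k : ℕ` stands for `t_{2k+1}`, and `x = t₁` has index `0`.
Laurent series are series in `λ⁻¹`: the exponent `e` of a Mathlib `LaurentSeries` stands for `λ^(-e)`,
so an element of `LaurentSeries ℂ` is `∑_{i ≤ i₀} c_i λ^i`. -/

/-- Formal functions of `t = (t₁, t₃, …)`. -/
abbrev Fun : Type := MvPowerSeries ℕ ℂ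

/-- Formal functions of `t` with values in `ℂ((λ⁻¹))`. -/
abbrev LFun : Type := MvPowerSeries ℕ (LaurentSeries ℂ)

/-- `∂/∂t_{2k+1}` on formal functions. -/
def dt (k : ℕ) (a : Fun) : Fun := MvPowerSeries.pderiv ℂ k a

/-- `∂/∂t_{2k+1}` on formal loop functions. -/
def dtL (k : ℕ) (a : LFun) : LFun := MvPowerSeries.pderiv (LaurentSeries ℂ) k a

/-- The spectral parameter `λ`. -/
def lam : LaurentSeries ℂ := HahnSeries.single (-1) 1

/-- `∂_λ = - z² ∂_z` for `z = λ⁻¹`. -/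
def dLam₀ (h : LaurentSeries ℂ) : LaurentSeries ℂ :=
  -(HahnSeries.single (2 : ℤ) (1 : ℂ) * LaurentSeries.hasseDeriv ℂ 1 h)

/-- `h(λ) ↦ h(-λ)`. -/
def flip₀ (h : LaurentSeries ℂ) : LaurentSeries ℂ where
  coeff e := (e.negOnePow : ℤ) * h.coeff e
  isPWO_support' := h.isPWO_support.mono (by
    intro e he hc
    exact he (by simp [hc]))

/-- `∂_λ`, coefficientwise in `t`. -/
def dLam (a : LFun) : LFun := fun α => dLam₀ (MvPowerSeries.coeff α a)

/-- `λ ↦ -λ`, coefficientwise in `t`. -/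
def flip (a : LFun) : LFun := fun α => flip₀ (MvPowerSeries.coeff α a)

/-- The part `∑_{i ≥ 0} a_i λ^i`. -/
def plus (a : LFun) : LFun := fun α => HahnSeries.truncLT (1 : ℤ) (MvPowerSeries.coeff α a)

/-- The coefficient of `λ^i`. -/
def coeffLam (i : ℤ) (a : LFun) : Fun := fun α => (MvPowerSeries.coeff α a).coeff (-i)

/-- Functions of `t` as loop functions that do not depend on `λ`. -/
def ofFun : Fun →+* LFun := MvPowerSeries.map HahnSeries.C

/-- Loops as loop functions that do not depend on `t`. -/
def ofLoop : LaurentSeries ℂ →+* LFun := MvPowerSeries.C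

/-! ### Matrices of size `2m+2n+1` -/

/-- The indices `i` and `m+i` (`1 ≤ i ≤ m`) and `2m+a` (`1 ≤ a ≤ 2n+1`), in this order. -/
abbrev Idx (m n : ℕ) : Type := (Fin m ⊕ Fin m) ⊕ Fin (2 * n + 1)

abbrev Mat (m n : ℕ) (R : Type) : Type := Matrix (Idx m n) (Idx m n) R

variable {m n : ℕ}

/-- `C_{m,n} = diag(α_m, β_n)`, with `C_{m,n}² = 1`. -/
def twistC (m n : ℕ) : Mat m n LFun :=
  fromBlocks
    (∑ i : Fin m, (single (Sum.inl i) (Sum.inr i.rev) 1 + single (Sum.inr i) (Sum.inl i.rev) 1))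
    0 0
    (∑ a : Fin (2 * n + 1), single a a.rev ((-1) ^ (n + (a : ℕ))))

/-- `diag(0_{2m}, b)` with `b = ∑ e_{i+1,i}`. -/
def bMat (m n : ℕ) (R : Type) [CommRing R] : Mat m n R :=
  fromBlocks 0 0 0 (∑ i : Fin (2 * n), single i.succ i.castSucc 1)

/-- `J(λ) = diag(0_{2m}, e_{1,2n+1} λ + b)`. -/
def J (m n : ℕ) : Mat m n (LaurentSeries ℂ) :=
  single (Sum.inr 0) (Sum.inr (Fin.last _)) lam + bMat m n (LaurentSeries ℂ)

/-- `J` as a loop function. -/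
def JL (m n : ℕ) : Mat m n LFun := (J m n).map ofLoop

/-- The symmetry condition `σ(g(-λ)) = g(λ)`, where `σ(Y) = (C Yᵗ C⁻¹)⁻¹` and `C⁻¹ = C`. -/
def Twisted (g : Mat m n LFun) : Prop :=
  g * (twistC m n * (g.map flip)ᵀ * twistC m n) = 1

/-- Formal functions with values in the negative loop group: `g = 1 + ∑_{i<0} g_i λ^i`. -/
structure InMinus (g : Mat m n LFun) : Prop where
  plus_eq : g.map plus = 1
  det_eq : g.det = 1
  twisted : Twisted g

/-- Formal functions with values in the positive loop group. As some of the `J^{2i-1}` have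
nonzero trace, the determinant is only required to be invertible. -/
structure InPlus (g : Mat m n LFun) : Prop where
  plus_eq : g.map plus = g
  isUnit_det : IsUnit g.det
  twisted : Twisted g

/-- `W(t) = exp(-∑_k t_{2k+1} J^{2k+1})`: the coefficient of `t^α` is
`(-1)^{|α|} / α! • J^{∑_k (2k+1) α_k}`. -/
def vacuum (m n : ℕ) : Mat m n LFun :=
  Matrix.of fun i j => fun α =>
    ((-1 : ℂ) ^ α.degree / (α.prod fun _ a => (a.factorial : ℂ))) •
      (J m n ^ (α.sum fun k a => (2 * k + 1) * a)) i j

/-! ### The central extension and the tau function -/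

/-- `⟨ξ, η⟩_{-1} = ∑_j tr(ξ_j η_{-j-1})`. -/
def pairing (ξ η : Mat m n LFun) : Fun := coeffLam (-1) (trace (ξ * η))

/-- The 2-cocycle `w(ξ, η) = ⟨ξ_λ, η⟩_{-1}`. -/
def cocycle (ξ η : Mat m n LFun) : Fun := pairing (ξ.map dLam) η

/-- The central extension of the loop algebra, with coefficients in the formal functions. -/
@[ext] structure ExtAlg (m n : ℕ) where
  loop : Mat m n LFun
  central : Fun

/-- The bracket `[(ξ, a), (η, b)] = ([ξ, η], w(ξ, η))`. -/
def ExtAlg.bracket (X Y : ExtAlg m n) : ExtAlg m n :=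
  ⟨X.loop * Y.loop - Y.loop * X.loop, cocycle X.loop Y.loop⟩

/-- The adjoint action of the loop group on the extended algebra; its derivative at the identity in
the direction `ζ` is `X ↦ [(ζ, 0), X]`. -/
def ExtAlg.Ad (g : Mat m n LFun) (X : ExtAlg m n) : ExtAlg m n :=
  ⟨g * X.loop * g⁻¹, X.central + pairing (g⁻¹ * g.map dLam) X.loop⟩

/-- A formal function `g̃` of `t` with values in the central extension of the loop group and with
`g̃(0) = c • S(g(0))`, `g(0)` in the negative group. It is recorded by its projection `g`, by `c`,
and by the central components of its logarithmic derivatives `(∂_{t_{2k+1}} g̃) g̃⁻¹`, which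
are functions with values in the extended algebra. -/
@[ext] structure ExtLoop (m n : ℕ) where
  loop : Mat m n LFun
  base : ℂ
  conn : ℕ → Fun

/-- The logarithmic derivative `(∂_{t_{2k+1}} g̃) g̃⁻¹`. -/
def ExtLoop.logDeriv (X : ExtLoop m n) (k : ℕ) : ExtAlg m n :=
  ⟨X.loop.map (dtL k) * X.loop⁻¹, X.conn k⟩

/-- The product: `∂(g̃ h̃) (g̃ h̃)⁻¹ = (∂ g̃) g̃⁻¹ + Ad(g) ((∂ h̃) h̃⁻¹)`. -/
def ExtLoop.mul (X Y : ExtLoop m n) : ExtLoop m n :=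
  ⟨X.loop * Y.loop, X.base * Y.base,
    fun k => (X.logDeriv k).central + (ExtAlg.Ad X.loop (Y.logDeriv k)).central⟩

/-- The nowhere vanishing function `τ` as a function with values in the centre. -/
def ExtLoop.scalar (m n : ℕ) (τ : Fun) : ExtLoop m n :=
  ⟨1, MvPowerSeries.constantCoeff τ, fun k => dt k τ * τ⁻¹⟩

/-- The natural lift `S` of the positive and of the negative group, on which the cocycle vanishes. -/
def ExtLoop.lift (g : Mat m n LFun) : ExtLoop m n := ⟨g, 1, 0⟩

/-- `W f⁻¹ = M⁻¹ E` with `M` negative and `E` positive, and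
`S(W) S(f⁻¹) = τ S(M⁻¹) S(E)` in the central extension. -/
structure IsTau (f : Mat m n (LaurentSeries ℂ)) (M E : Mat m n LFun) (τ : Fun) : Prop where
  f_mem : InMinus (f.map ofLoop)
  M_mem : InMinus M
  E_mem : InPlus E
  factor : vacuum m n * (f.map ofLoop)⁻¹ = M⁻¹ * E
  lift_eq : (ExtLoop.lift (vacuum m n)).mul (ExtLoop.lift (f.map ofLoop)⁻¹) =
    ((ExtLoop.scalar m n τ).mul (ExtLoop.lift M⁻¹)).mul (ExtLoop.lift E)

/-- `(ln τ)_{t_{2i+1} t_{2k+1}}`. -/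
def logTau₂ (τ : Fun) (i k : ℕ) : Fun := dt i (dt k τ * τ⁻¹)

/-! ### The matrix constrained CKP hierarchy -/

/-- The coordinates `q_1,…,q_m`, `r_1,…,r_m`, `u_1,…,u_n` on `V_{m,n}`, as functions of `t`. -/
structure Fields (m n : ℕ) where
  q : Fin m → Fun
  r : Fin m → Fun
  u : Fin n → Fun

/-- `μ_i = e_{i,2m+2n+1} + (-1)^{n+1} e_{2m+1,2m+1-i}`. -/
def mu (i : Fin m) : Mat m n Fun :=
  single (Sum.inl (Sum.inl i)) (Sum.inr (Fin.last _)) 1 +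
    single (Sum.inr 0) (Sum.inl (Sum.inr i.rev)) ((-1) ^ (n + 1))

/-- `ν_i = (-1)^n e_{m+i,2m+2n+1} - e_{2m+1,m+1-i}`. -/
def nu (i : Fin m) : Mat m n Fun :=
  single (Sum.inl (Sum.inr i)) (Sum.inr (Fin.last _)) ((-1) ^ n) -
    single (Sum.inr 0) (Sum.inl (Sum.inl i.rev)) 1

/-- `ω_i = - e_{2m+n+1-i,2m+n+i} - e_{2m+n+2-i,2m+n+1+i}`, where `i = k + 1`. -/
def omega (k : Fin n) : Mat m n Fun :=
  -single (Sum.inr ⟨n - 1 - k, by omega⟩) (Sum.inr ⟨n + k, by omega⟩) 1 -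
    single (Sum.inr ⟨n - k, by omega⟩) (Sum.inr ⟨n + k + 1, by omega⟩) 1

/-- `u = ∑ q_i μ_i + ∑ r_{m+1-i} ν_i + ∑ u_i ω_i`. -/
def Fields.toMat (v : Fields m n) : Mat m n Fun :=
  ∑ i, v.q i • mu i + ∑ i, v.r (Fin.rev i) • nu i + ∑ k, v.u k • omega k

/-- `diag(1, Δ₂₂)` with `Δ₂₂` upper triangular with ones on the diagonal. -/
def IsGauge (Δ : Mat m n Fun) : Prop :=
  ∃ D : Matrix (Fin (2 * n + 1)) (Fin (2 * n + 1)) Fun,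
    Δ = fromBlocks 1 0 0 D ∧ (∀ a, D a a = 1) ∧ ∀ a b, b < a → D a b = 0

/-- `diag(0, η₂₂)` with `η₂₂` strictly upper triangular. -/
def IsStrictUpper (η : Mat m n Fun) : Prop :=
  ∃ D : Matrix (Fin (2 * n + 1)) (Fin (2 * n + 1)) Fun,
    η = fromBlocks 0 0 0 D ∧ ∀ a b, b ≤ a → D a b = 0

/-- `S = S(u, λ)`: `[∂_x + J + u, S] = 0`, and `S` is conjugate to `J` by `Δ g` with `Δ` a gauge
matrix and `g` in the negative group (`S(u, λ) = Δ S(q, λ) Δ⁻¹` for `u = Δ * q`). -/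
def IsResolvent (v : Fields m n) (S : Mat m n LFun) : Prop :=
  S.map (dtL 0) + (JL m n + v.toMat.map ofFun) * S - S * (JL m n + v.toMat.map ofFun) = 0 ∧
  ∃ (Δ : Mat m n Fun) (g : Mat m n LFun), IsGauge Δ ∧ InMinus g ∧
    S = (Δ.map ofFun * g) * JL m n * (Δ.map ofFun * g)⁻¹

/-- `u` solves all flows
`u_{t_{2k+1}} = [∂_x + diag(0, b) + u, S_{2k+1,0}(u) + η_{2k+1}(u)]`, `x = t₁`. -/
def IsSolution (v : Fields m n) : Prop :=
  ∃ (S : Mat m n LFun) (η : ℕ → Mat m n Fun), IsResolvent v S ∧ ∀ k,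
    IsStrictUpper (η k) ∧
    v.toMat.map (dt k) =
      ((S ^ (2 * k + 1)).map (coeffLam 0) + η k).map (dt 0)
      + (bMat m n Fun + v.toMat) * ((S ^ (2 * k + 1)).map (coeffLam 0) + η k)
      - ((S ^ (2 * k + 1)).map (coeffLam 0) + η k) * (bMat m n Fun + v.toMat)

/-- `u` is the formal inverse scattering solution attached to `f`, where `M` is the negative factor
of `W f⁻¹`: `u = Δ * q`, that is `Δ (∂_x + J + q) Δ⁻¹ = ∂_x + J + u`, for `J + q = (M J M⁻¹)_+`. -/
def IsAttached (M : Mat m n LFun) (v : Fields m n) : Prop :=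
  ∃ Δ : Mat m n Fun, IsGauge Δ ∧
    Δ.map ofFun * (M * JL m n * M⁻¹).map plus - (Δ.map ofFun).map (dtL 0) =
      (JL m n + v.toMat.map ofFun) * Δ.map ofFun

/-! ### Differential polynomials -/

/-- The letters `∂_x^k q_i`, `∂_x^k r_i`, `∂_x^k u_i`, each written as a pair `(i, k)`. -/
inductive Letter (m n : ℕ) : Type
  | q (i : Fin m) (k : ℕ)
  | r (i : Fin m) (k : ℕ)
  | u (i : Fin n) (k : ℕ)

/-- The value of a letter on `v`. -/
def Letter.val (v : Fields m n) : Letter m n → Fun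
  | .q i k => (dt 0)^[k] (v.q i)
  | .r i k => (dt 0)^[k] (v.r i)
  | .u i k => (dt 0)^[k] (v.u i)

/-- The value of a differential polynomial on `v`. -/
def evalDiff (v : Fields m n) (P : MvPolynomial (Letter m n) ℂ) : Fun :=
  MvPolynomial.aeval (Letter.val v) P

/-- `P` is a polynomial in the `x`-derivatives of `u_1,…,u_{j-1}` (zero-based: `u_i`, `i < j`). -/
def InvolvesOnlyULt (j : ℕ) (P : MvPolynomial (Letter m n) ℂ) : Prop :=
  ∀ l ∈ P.vars, ∃ (i : Fin n) (k : ℕ), (i : ℕ) < j ∧ l = .u i k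

/-- The derivatives of the `q_i` and `r_i` in `P` have order at most `d`. -/
def QROrderLE (d : ℕ) (P : MvPolynomial (Letter m n) ℂ) : Prop :=
  ∀ l ∈ P.vars, ∀ i k, l = .q i k ∨ l = .r i k → k ≤ d

/-- `P` involves no `u_i`. -/
def InvolvesNoU (P : MvPolynomial (Letter m n) ℂ) : Prop :=
  ∀ l ∈ P.vars, ∀ i k, l ≠ .u i k

end

end CCKP

/-! Write N = 2n+1.

Residue formula. Separating the powers of λ in E = M W f⁻¹ gives M_t M⁻¹ = A - A₊ with A = M
J^(2k+1) M⁻¹. Comparing central components of the two lifted factorizations then gives (ln τ)_t =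
-Res tr(M_λ J^(2k+1) M⁻¹), and one more x-derivative turns this into Res tr(((M J M⁻¹)₊)_λ A)
(`IsTau.logTau₂_eq`). Gauge matrices do not depend on λ, and ∂_x + J + u depends on λ only through
the entry λ e_{1,N}. So what remains is the coefficient of λ⁻¹ in the (N,1) entry of S^(2k+1), where
S = ΔM J (ΔM)⁻¹ (`IsTau.exists_dressing`).

Universality. After λ = z^N and conjugation by a diagonal of powers of z, J becomes zΛ with Λ a
constant cyclic matrix, and S becomes zσ. Here σ = Λ + O(X) is a power series in X = z⁻¹ with X σ' +
[Λ + U, σ] = 0 and σ^(N+1) = σ (`IsTau.exists_principal`). The differential equation controls the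
commutator [Λ, σ - Λ], and the power identity controls the part that commutes with Λ. Together they
make σ a fixed point of an X-adic contraction, `step`. Finitely many iterations on the generic
potential therefore produce each coefficient as a differential polynomial (`tauPoly`, `map_tauPoly`,
`IsTau.logTau_eq`).

Variables. Give q_i, r_i weight n+1 and odd parity, u_i weight 2i and even parity, and let ∂_x add
one to the weight. The contraction respects this, so the polynomial for t_{2k+1} is even of weight
2k+2. A monomial with one odd letter has a second one, hence weight at least 2n+2 plus the order of
that letter. This excludes q and r for k < n and bounds their order for k ≥ n. For k < n the same
count allows, besides the lower u's, only the monomial u_{k+1} itself. Its coefficient is found over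
the dual numbers, where the fixed point is explicit (`coeff_tauPoly`).

The flow t_N. Since J^N = λ · proj, the matrix needed is λ times an idempotent deforming `proj`.
Idempotency and the first order of the differential equation give the required entry, 2 ∑ q_i r_i,
without any u_i (`IsTau.logTau_card`). -/

namespace CCKP

noncomputable section

/-! ### A contraction with prescribed fixed point -/

section Telescoping

variable {A : Type*} [Ring A]

/-- `∑_{i<n} xⁱ d yⁿ⁻¹⁻ⁱ`. -/
def powSum (x y d : A) (n : ℕ) : A := ∑ i ∈ Finset.range n, x ^ i * d * y ^ (n - 1 - i)

lemma powSum_succ (x y d : A) (n : ℕ) : powSum x y d (n + 1) = powSum x y d n * y + x ^ n * d := by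
  unfold powSum
  rw [Finset.sum_range_succ, Finset.sum_mul]
  congr 1
  · refine Finset.sum_congr rfl fun i hi => ?_
    have : n + 1 - 1 - i = (n - 1 - i) + 1 := by have := Finset.mem_range.1 hi; omega
    rw [this, pow_succ, mul_assoc]
    simp only [mul_assoc]
  · simp

/-- The sum telescopes. With d = 1 it factors xⁿ - yⁿ; with x = y it expresses [xⁿ, d] through [x,
d]. -/
lemma powSum_commutator (x y d : A) (n : ℕ) :
    powSum x y (x * d - d * y) n = x ^ n * d - d * y ^ n := by
  induction n with
  | zero => simp [powSum]
  | succ n ih => rw [powSum_succ, ih, pow_succ, pow_succ]; noncomm_ring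

lemma powSum_sub (x y : A) (n : ℕ) : powSum x y (x - y) n = x ^ n - y ^ n := by
  simpa using powSum_commutator x y 1 n

/-- The part of `σ^(k+1) - Λ^(k+1)` of order at least two in `σ - Λ`. -/
def powRem (k : ℕ) (Λ σ : A) : A :=
  ∑ i ∈ Finset.range (k + 1), (σ ^ i - Λ ^ i) * (σ - Λ) * Λ ^ (k - i)

/-- In the telescoped difference of powers, each left factor σ^i is replaced by Λ^i; the corrections
make up the remainder. -/
lemma pow_eq_powSum_add_powRem (k : ℕ) (Λ σ : A) :
    σ ^ (k + 1) = Λ ^ (k + 1) + powSum Λ Λ (σ - Λ) (k + 1) + powRem k Λ σ := by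
  have h := powSum_sub σ Λ (k + 1)
  have : powSum σ Λ (σ - Λ) (k + 1) = powSum Λ Λ (σ - Λ) (k + 1) + powRem k Λ σ := by
    simp only [powSum, powRem, ← Finset.sum_add_distrib]
    refine Finset.sum_congr rfl fun i _ => ?_
    simp only [Nat.add_sub_cancel]
    noncomm_ring
  rw [add_assoc, ← this, h]; abel

/-- `∑_{i≤k} Λⁱ [Λᵏ⁻ⁱ, s]` in terms of `κ = [Λ, s]`. -/
def commSum (k : ℕ) (Λ κ : A) : A :=
  ∑ i ∈ Finset.range (k + 1), Λ ^ i * powSum Λ Λ κ (k - i)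

lemma powSum_eq_commSum (k : ℕ) (Λ s : A) :
    powSum Λ Λ s (k + 1) = ((k : A) + 1) * (Λ ^ k * s) - commSum k Λ (Λ * s - s * Λ) := by
  have : ((k : A) + 1) * (Λ ^ k * s) = ∑ i ∈ Finset.range (k + 1), Λ ^ k * s := by
    simp [add_mul]
  rw [this, commSum, powSum, ← Finset.sum_sub_distrib]
  refine Finset.sum_congr rfl fun i hi => ?_
  have hik : i + (k - i) = k := by have := Finset.mem_range.1 hi; omega
  rw [powSum_commutator, mul_sub, ← mul_assoc, ← pow_add, hik, Nat.add_sub_cancel]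
  simp [mul_assoc]

/-- The power identity is solved for its linear term in σ - Λ. Moving σ - Λ to the right of all
powers of Λ costs only commutators with Λ, which the differential equation will supply. -/
lemma fixed_eq (k : ℕ) {Λ σ : A} (hΛ : Λ ^ (k + 1) = Λ) (hσ : σ ^ (k + 1) = σ) :
    (((k : A) + 1) * Λ ^ k - 1) * (σ - Λ) =
      commSum k Λ (Λ * σ - σ * Λ) - powRem k Λ σ := by
  have h := pow_eq_powSum_add_powRem k Λ σ
  rw [hσ, hΛ, powSum_eq_commSum] at h
  have h2 : Λ * (σ - Λ) - (σ - Λ) * Λ = Λ * σ - σ * Λ := by noncomm_ring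
  rw [h2] at h
  rw [sub_mul, one_mul, mul_assoc]
  nth_rewrite 2 [h]
  abel

end Telescoping

/-! ### X-adic congruences between matrices of power series -/

section Divisibility

open PowerSeries

variable {I : Type*} {B : Type*} [CommRing B]

/-- A map of coefficients applied to a power series. -/
def coeffwise (D : B → B) (a : B⟦X⟧) : B⟦X⟧ := PowerSeries.mk fun i => D (coeff i a)

@[simp] lemma coeff_coeffwise (D : B → B) (a : B⟦X⟧) (i : ℕ) :
    coeff i (coeffwise D a) = D (coeff i a) := coeff_mk _ _

/-- All entries are divisible by `X ^ w`. -/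
def DvdX (w : ℕ) (A : Matrix I I B⟦X⟧) : Prop := ∀ a b, (X : B⟦X⟧) ^ w ∣ A a b

namespace DvdX

variable {v w : ℕ} {A A' : Matrix I I B⟦X⟧}

lemma zero : DvdX w (0 : Matrix I I B⟦X⟧) := fun _ _ => dvd_zero _

lemma of_zero : DvdX 0 A := fun _ _ => by simp

lemma add (h : DvdX w A) (h' : DvdX w A') : DvdX w (A + A') := fun a b => dvd_add (h a b) (h' a b)

lemma neg (h : DvdX w A) : DvdX w (-A) := fun a b => (dvd_neg.2 (h a b))

lemma sub (h : DvdX w A) (h' : DvdX w A') : DvdX w (A - A') := fun a b => dvd_sub (h a b) (h' a b)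

lemma sum {ι : Type*} {s : Finset ι} {F : ι → Matrix I I B⟦X⟧} (h : ∀ i ∈ s, DvdX w (F i)) :
    DvdX w (∑ i ∈ s, F i) := fun a b => by
  rw [Matrix.sum_apply]; exact Finset.dvd_sum fun i hi => h i hi a b

lemma mul [Fintype I] (h : DvdX v A) (h' : DvdX w A') : DvdX (v + w) (A * A') := fun a b => by
  rw [Matrix.mul_apply, pow_add]
  exact Finset.dvd_sum fun c _ => mul_dvd_mul (h a c) (h' c b)

lemma mul_left [Fintype I] (h : DvdX w A) (A' : Matrix I I B⟦X⟧) : DvdX w (A' * A) := by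
  simpa using (of_zero (A := A')).mul h

lemma mul_right [Fintype I] (h : DvdX w A) (A' : Matrix I I B⟦X⟧) : DvdX w (A * A') := by
  simpa using h.mul (of_zero (A := A'))

lemma X_smul (h : DvdX w A) : DvdX (w + 1) ((X : B⟦X⟧) • A) := fun a b => by
  rw [pow_succ', Matrix.smul_apply, smul_eq_mul]; exact mul_dvd_mul_left _ (h a b)

lemma powSum [Fintype I] [DecidableEq I] (h : DvdX w A) (x y : Matrix I I B⟦X⟧) (n : ℕ) :
    DvdX w (powSum x y A n) :=
  sum fun _ _ => (h.mul_left _).mul_right _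

lemma commSum [Fintype I] [DecidableEq I] (h : DvdX w A) (k : ℕ) (x : Matrix I I B⟦X⟧) :
    DvdX w (commSum k x A) :=
  sum fun _ _ => (h.powSum _ _ _).mul_left _

lemma pow_sub_pow [Fintype I] [DecidableEq I] (h : DvdX w (A - A')) (n : ℕ) :
    DvdX w (A ^ n - A' ^ n) := by
  rw [← powSum_sub]; exact h.powSum _ _ _

/-- Every term of the remainder is at least quadratic in the deviation from Λ, so a difference of
remainders keeps one extra factor divisible by X. -/
lemma powRem_sub_powRem [Fintype I] [DecidableEq I] {Λ : Matrix I I B⟦X⟧} (h₁ : DvdX 1 (A - Λ))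
    (h₂ : DvdX 1 (A' - Λ)) (h : DvdX w (A - A')) (k : ℕ) :
    DvdX (w + 1) (powRem k Λ A - powRem k Λ A') := by
  rw [powRem, powRem, ← Finset.sum_sub_distrib]
  refine sum fun i _ => ?_
  have : (A ^ i - Λ ^ i) * (A - Λ) * Λ ^ (k - i) - (A' ^ i - Λ ^ i) * (A' - Λ) * Λ ^ (k - i) =
      ((A ^ i - A' ^ i) * (A - Λ) + (A' ^ i - Λ ^ i) * (A - A')) * Λ ^ (k - i) := by noncomm_ring
  rw [this]
  refine mul_right (((h.pow_sub_pow i).mul h₁).add ?_) _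
  rw [add_comm w]
  exact (h₂.pow_sub_pow i).mul h

lemma map_coeffwise_sub {D : B → B} (h : DvdX w (A - A')) :
    DvdX w (A.map (coeffwise D) - A'.map (coeffwise D)) := fun a b => by
  rw [X_pow_dvd_iff]
  intro i hi
  have := (X_pow_dvd_iff.1 (h a b)) i hi
  simp only [Matrix.sub_apply, map_sub, sub_eq_zero] at this
  simp [this]

lemma coeff_eq (h : DvdX w (A - A')) {i : ℕ} (hi : i < w) (a b : I) :
    coeff i (A a b) = coeff i (A' a b) := by
  have := (X_pow_dvd_iff.1 (h a b)) i hi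
  rwa [Matrix.sub_apply, map_sub, sub_eq_zero] at this

end DvdX

end Divisibility

/-! ### The contraction: fixed points, convergence and base change -/

section Step

open PowerSeries

variable {I : Type*} [Fintype I] [DecidableEq I]
variable {B : Type*} [CommRing B] [Algebra ℂ B]

/-- The map whose fixed points are the solutions of `X σ' + [Λ + U, σ] = 0`, `σ^(k+1) = σ`. -/
def step (k : ℕ) (D : B → B) (Λ U σ : Matrix I I B⟦X⟧) : Matrix I I B⟦X⟧ :=
  Λ + ((k : ℂ)⁻¹ • Λ ^ k + Λ ^ k - 1) *
    (commSum k Λ (-((X : B⟦X⟧) • σ.map (coeffwise D) + (U * σ - σ * U))) - powRem k Λ σ)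

lemma step_eq_self {k : ℕ} (hk : k ≠ 0) {D : B → B} {Λ U σ : Matrix I I B⟦X⟧}
    (hΛ : Λ ^ (k + 1) = Λ) (hσ : σ ^ (k + 1) = σ)
    (hD : (X : B⟦X⟧) • σ.map (coeffwise D) + ((Λ + U) * σ - σ * (Λ + U)) = 0) :
    step k D Λ U σ = σ := by
  have h1 : -((X : B⟦X⟧) • σ.map (coeffwise D) + (U * σ - σ * U)) = Λ * σ - σ * Λ := by
    rw [neg_eq_iff_add_eq_zero, ← hD]; noncomm_ring
  rw [step, h1, ← fixed_eq k hΛ hσ, ← mul_assoc]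
  -- Λ^k is a projection because Λ^(k+1) = Λ; this is where k ≠ 0 enters.
  have hP : Λ ^ k * Λ ^ k = Λ ^ k := by
    obtain ⟨j, rfl⟩ := Nat.exists_eq_succ_of_ne_zero hk
    rw [Nat.succ_eq_add_one, ← pow_add]
    rw [show j + 1 + (j + 1) = (j + 1 + 1) + j by ring, pow_add, hΛ, ← pow_succ']
  have hc : (k : Matrix I I B⟦X⟧) + 1 = ((k : ℂ) + 1) • (1 : Matrix I I B⟦X⟧) := by
    rw [add_smul, one_smul]
    congr 1
    rw [Nat.cast_smul_eq_nsmul, nsmul_eq_mul, mul_one]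
  -- For a projection P, (k+1)P - 1 is k on the image and -1 on the kernel, so its inverse (1/k +
  -- 1)P - 1 is 1/k and -1 there.
  have hQ : ((k : ℂ)⁻¹ • Λ ^ k + Λ ^ k - 1) *
      (((k : Matrix I I B⟦X⟧) + 1) * Λ ^ k - 1) = 1 := by
    rw [hc, smul_mul_assoc, one_mul]
    simp only [mul_sub, sub_mul, add_mul, mul_smul_comm, smul_mul_assoc, hP, mul_one, one_mul]
    have hk' : (k : ℂ) ≠ 0 := by exact_mod_cast hk
    match_scalars
    · field_simp; ring
    · field_simp
  rw [hQ, one_mul]; abel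

/-- Contraction by one power of X: the derivative carries an explicit X, U is divisible by X, and
the remainder is quadratic. -/
lemma DvdX.step_sub_step {w k : ℕ} {D : B → B} {Λ U σ σ' : Matrix I I B⟦X⟧} (hU : DvdX 1 U)
    (h₁ : DvdX 1 (σ - Λ)) (h₂ : DvdX 1 (σ' - Λ)) (h : DvdX w (σ - σ')) :
    DvdX (w + 1) (step k D Λ U σ - step k D Λ U σ') := by
  have hcs : ∀ x y : Matrix I I B⟦X⟧, CCKP.commSum k Λ x - CCKP.commSum k Λ y = CCKP.commSum k Λ (x - y) := by
    intro x y
    simp only [CCKP.commSum, CCKP.powSum, ← Finset.sum_sub_distrib, ← mul_sub, ← sub_mul]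
  have : step k D Λ U σ - step k D Λ U σ' = ((k : ℂ)⁻¹ • Λ ^ k + Λ ^ k - 1) *
      (CCKP.commSum k Λ (-((X : B⟦X⟧) • (σ.map (coeffwise D) - σ'.map (coeffwise D)) +
        (U * (σ - σ') - (σ - σ') * U))) - (powRem k Λ σ - powRem k Λ σ')) := by
    have h3 : -((X : B⟦X⟧) • (σ.map (coeffwise D) - σ'.map (coeffwise D)) +
        (U * (σ - σ') - (σ - σ') * U)) =
        -((X : B⟦X⟧) • σ.map (coeffwise D) + (U * σ - σ * U)) -
        -((X : B⟦X⟧) • σ'.map (coeffwise D) + (U * σ' - σ' * U)) := by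
      rw [smul_sub]; noncomm_ring
    rw [h3, ← hcs, step, step]; noncomm_ring
  rw [this]
  refine mul_left (sub (commSum (neg (add h.map_coeffwise_sub.X_smul (sub ?_ (h.mul hU)))) _ _)
    (powRem_sub_powRem h₁ h₂ h k)) _
  rw [add_comm w]
  exact hU.mul h

lemma DvdX.step_sub {k : ℕ} {D : B → B} {Λ U σ : Matrix I I B⟦X⟧} (hU : DvdX 1 U)
    (h : DvdX 1 (σ - Λ)) : DvdX 1 (step k D Λ U σ - Λ) := by
  rw [step, add_sub_cancel_left]
  refine mul_left (sub (commSum (neg (add (by simpa using of_zero.X_smul)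
    (sub (hU.mul_right _) (hU.mul_left _)))) _ _) ?_) _
  exact sum fun i _ => (h.mul_left _).mul_right _

/-- A fixed point that starts with Λ is thus determined by U, and its coefficients up to X^w are
those of the w-th iterate. -/
lemma DvdX.sub_iterate_step {k : ℕ} {D : B → B} {Λ U σ : Matrix I I B⟦X⟧} (hU : DvdX 1 U)
    (h : DvdX 1 (σ - Λ)) (hs : step k D Λ U σ = σ) (w : ℕ) :
    DvdX (w + 1) (σ - (step k D Λ U)^[w] Λ) := by
  have aux : ∀ w, DvdX 1 ((step k D Λ U)^[w] Λ - Λ) := by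
    intro w
    induction w with
    | zero => simpa using DvdX.zero
    | succ w ih => rw [Function.iterate_succ_apply']; exact step_sub hU ih
  induction w with
  | zero => simpa using h
  | succ w ih =>
    rw [Function.iterate_succ_apply']
    nth_rewrite 1 [← hs]
    exact step_sub_step hU h (aux w) ih

variable {B' : Type*} [CommRing B'] [Algebra ℂ B']

/-- `step` uses only ring operations, complex scalars and D, so the generic computation specializes
along any algebra map that intertwines the two maps D. -/
lemma map_step (φ : B →ₐ[ℂ] B') {D : B → B} {D' : B' → B'} (hD : ∀ a, φ (D a) = D' (φ a))
    (k : ℕ) (Λ U σ : Matrix I I B⟦X⟧) :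
    (PowerSeries.map φ.toRingHom).mapMatrix (step k D Λ U σ) =
      step k D' ((PowerSeries.map φ.toRingHom).mapMatrix Λ)
        ((PowerSeries.map φ.toRingHom).mapMatrix U)
        ((PowerSeries.map φ.toRingHom).mapMatrix σ) := by
  set F := (PowerSeries.map φ.toRingHom).mapMatrix (m := I) with hF
  have hsmul : ∀ (c : ℂ) (A : Matrix I I B⟦X⟧), F (c • A) = c • F A := by
    intro c A
    ext a b i
    simp [hF]
  have hX : ∀ A : Matrix I I B⟦X⟧, F ((X : B⟦X⟧) • A) = (X : B'⟦X⟧) • F A := by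
    intro A
    ext a b i
    simp [hF]
  have hmap : F (σ.map (coeffwise D)) = (F σ).map (coeffwise D') := by
    ext a b i
    simp [hF, hD]
  simp only [step, commSum, powRem, powSum, map_add, map_sub, map_mul, map_neg, map_pow, map_sum,
    map_one, hsmul, hX, hmap]

lemma map_iterate_step (φ : B →ₐ[ℂ] B') {D : B → B} {D' : B' → B'}
    (hD : ∀ a, φ (D a) = D' (φ a)) (k : ℕ) (Λ U : Matrix I I B⟦X⟧) (w : ℕ) :
    (PowerSeries.map φ.toRingHom).mapMatrix ((step k D Λ U)^[w] Λ) =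
      (step k D' ((PowerSeries.map φ.toRingHom).mapMatrix Λ)
        ((PowerSeries.map φ.toRingHom).mapMatrix U))^[w]
          ((PowerSeries.map φ.toRingHom).mapMatrix Λ) := by
  induction w with
  | zero => rfl
  | succ w ih => rw [Function.iterate_succ_apply', Function.iterate_succ_apply', map_step φ hD, ih]

end Step

end

end CCKP

namespace CCKP

noncomputable section

/-! ### The normalized potential and the cyclic matrix -/

section Normalized

open PowerSeries

variable {m n : ℕ} {B : Type} [CommRing B]

/-- The principal grading: the position of an index, with the first block in the middle. -/
def pos : Idx m n → ℕ
  | .inl _ => n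
  | .inr a => a

/-- The block of an index. -/
def blk : Idx m n → ZMod 2
  | .inl _ => 1
  | .inr _ => 0

lemma pos_le (a : Idx m n) : pos a ≤ 2 * n := by
  rcases a with a | a
  · simp [pos]; omega
  · simp [pos]; omega

/-- The cyclic shift of the second block by `k` places. -/
def shift (n : ℕ) (R : Type) [CommRing R] (k : ℕ) :
    Matrix (Fin (2 * n + 1)) (Fin (2 * n + 1)) R :=
  Matrix.of fun a b => if (a : ℕ) = (b + k) % (2 * n + 1) then 1 else 0

lemma shift_mul_shift (j k : ℕ) : shift n B j * shift n B k = shift n B (j + k) := by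
  ext a b
  rw [Matrix.mul_apply, Finset.sum_eq_single ⟨(b + k) % (2 * n + 1), Nat.mod_lt _ (by omega)⟩]
  · simp only [shift, Matrix.of_apply, if_true, mul_one]
    have : ((b + k) % (2 * n + 1) + j) % (2 * n + 1) = (b + (j + k)) % (2 * n + 1) := by
      rw [Nat.mod_add_mod]; congr 1; ring
    rw [this]
  · intro c _ hc
    have : ¬ (c : ℕ) = (b + k) % (2 * n + 1) := fun h => hc (Fin.ext h)
    simp [shift, this]
  · simp

/-- `diag(0, b + e_{1,N})`. -/
def cyc (m n : ℕ) (R : Type) [CommRing R] : Mat m n R := fromBlocks 0 0 0 (shift n R 1)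

lemma cyc_pow_succ (k : ℕ) : cyc m n B ^ (k + 1) = fromBlocks 0 0 0 (shift n B (k + 1)) := by
  induction k with
  | zero => simp [cyc]
  | succ k ih => rw [pow_succ, ih, cyc, fromBlocks_multiply]; simp [shift_mul_shift]

lemma shift_add (k : ℕ) : shift n B (2 * n + 1 + k) = shift n B k := by
  ext a b
  have : (b + (2 * n + 1 + k)) % (2 * n + 1) = (b + k) % (2 * n + 1) := by
    rw [show (b : ℕ) + (2 * n + 1 + k) = (b + k) + (2 * n + 1) by ring, Nat.add_mod_right]
  simp [shift, this]

lemma shift_zero : shift n B 0 = 1 := by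
  ext a b
  simp only [shift, Matrix.of_apply, add_zero, Nat.mod_eq_of_lt b.2, Matrix.one_apply, Fin.ext_iff]

/-- The projection onto the second block. -/
def proj (m n : ℕ) (R : Type) [CommRing R] : Mat m n R := fromBlocks 0 0 0 1

lemma cyc_pow_card : cyc m n B ^ (2 * n + 1) = proj m n B := by
  rw [cyc_pow_succ]
  have := shift_add (n := n) (B := B) 0
  rw [add_zero] at this
  rw [this, shift_zero, proj]

lemma cyc_pow_card_succ : cyc m n B ^ (2 * n + 1 + 1) = cyc m n B := by
  rw [cyc_pow_succ, shift_add, cyc]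

lemma cyc_pow_inr_inr (k : ℕ) (a b : Fin (2 * n + 1)) :
    (cyc m n B ^ k) (.inr a) (.inr b) = if (a : ℕ) = (b + k) % (2 * n + 1) then 1 else 0 := by
  cases k with
  | zero => simp [Matrix.one_apply, Nat.mod_eq_of_lt b.2, Fin.ext_iff]
  | succ k => rw [cyc_pow_succ]; simp [shift]

/-- `μ_i` over any ring. -/
def genMu (B : Type) [CommRing B] (i : Fin m) : Mat m n B :=
  single (Sum.inl (Sum.inl i)) (Sum.inr (Fin.last _)) 1 +
    single (Sum.inr 0) (Sum.inl (Sum.inr i.rev)) ((-1) ^ (n + 1))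

/-- `ν_i` over any ring. -/
def genNu (B : Type) [CommRing B] (i : Fin m) : Mat m n B :=
  single (Sum.inl (Sum.inr i)) (Sum.inr (Fin.last _)) ((-1) ^ n) -
    single (Sum.inr 0) (Sum.inl (Sum.inl i.rev)) 1

/-- `ω_i` over any ring. -/
def genOmega (B : Type) [CommRing B] (k : Fin n) : Mat m n B :=
  -single (Sum.inr ⟨n - 1 - k, by omega⟩) (Sum.inr ⟨n + k, by omega⟩) 1 -
    single (Sum.inr ⟨n - k, by omega⟩) (Sum.inr ⟨n + k + 1, by omega⟩) 1

/-- The general element of `V_{m,n}` over any ring. -/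
def potential (q r : Fin m → B) (u : Fin n → B) : Mat m n B :=
  ∑ i, q i • genMu B i + ∑ i, r (Fin.rev i) • genNu B i + ∑ k, u k • genOmega B k

lemma toMat_eq (v : Fields m n) : v.toMat = potential v.q v.r v.u := rfl

lemma map_potential {B' : Type} [CommRing B'] (φ : B →+* B') (q r : Fin m → B) (u : Fin n → B) :
    φ.mapMatrix (potential q r u) = potential (φ ∘ q) (φ ∘ r) (φ ∘ u) := by
  have hs : ∀ (c : B) (A : Mat m n B), φ.mapMatrix (c • A) = φ c • φ.mapMatrix A := by
    intro c A; ext; simp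
  simp only [potential, map_add, map_sum, hs, genMu, genNu, genOmega, map_sub, map_neg,
    RingHom.mapMatrix_apply, Matrix.map_single, map_one, map_pow, Function.comp]

/-- The potential with `X` recording the principal grading. -/
def scaled (A : Mat m n B) : Mat m n B⟦X⟧ :=
  Matrix.of fun a b => X ^ (pos b + 1 - pos a) * C (A a b)

lemma scaled_add (A A' : Mat m n B) : scaled (A + A') = scaled A + scaled A' := by
  ext1 a b; simp [scaled, mul_add]

lemma scaled_neg (A : Mat m n B) : scaled (-A) = -scaled A := by
  ext1 a b; simp [scaled]

lemma scaled_sum {ι : Type*} (s : Finset ι) (F : ι → Mat m n B) :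
    scaled (∑ i ∈ s, F i) = ∑ i ∈ s, scaled (F i) := by
  ext1 a b; simp [scaled, Matrix.sum_apply, Finset.mul_sum]

lemma scaled_single (i j : Idx m n) (c : B) :
    scaled (single i j c) = single i j (X ^ (pos j + 1 - pos i) * C c) := by
  ext1 a b
  simp only [scaled, Matrix.of_apply, Matrix.single_apply]
  split_ifs with h
  · rw [h.1, h.2]
  · simp

lemma map_scaled {B' : Type} [CommRing B'] (φ : B →+* B') (A : Mat m n B) :
    (PowerSeries.map φ).mapMatrix (scaled A) = scaled (φ.mapMatrix A) := by
  ext1 a b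
  simp [scaled]

lemma map_cyc {B' : Type} [CommRing B'] (φ : B →+* B') :
    φ.mapMatrix (cyc m n B) = cyc m n B' := by
  ext a b
  rcases a with a | a <;> rcases b with b | b <;> simp [cyc, shift, apply_ite φ]

/-- The entries strictly below the principal diagonal vanish. -/
def PosUpper (A : Mat m n B) : Prop := ∀ a b, pos b < pos a → A a b = 0

lemma posUpper_single {i j : Idx m n} (h : pos i ≤ pos j) (c : B) : PosUpper (single i j c) := by
  intro a b hab
  rw [Matrix.single_apply, if_neg]
  rintro ⟨rfl, rfl⟩
  omega

/-- The units of μ and ν raise `pos` by n (to or from the middle position) and those of ω_i by 2i-1.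
Hence the truncated exponent in `scaled` is a true difference on the support, and U is divisible by
X. -/
lemma posUpper_potential (q r : Fin m → B) (u : Fin n → B) : PosUpper (potential q r u) := by
  intro a b hab
  have h1 : ∀ i, genMu (n := n) B i a b = 0 := fun i : Fin m => by
    rw [genMu, Matrix.add_apply, posUpper_single _ _ a b hab, posUpper_single _ _ a b hab, add_zero]
    · simp [pos]
    · simp [pos]; omega
  have h2 : ∀ i, genNu (n := n) B i a b = 0 := fun i : Fin m => by
    rw [genNu, Matrix.sub_apply, posUpper_single _ _ a b hab, posUpper_single _ _ a b hab, sub_zero]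
    · simp [pos]
    · simp [pos]; omega
  have h3 : ∀ k, genOmega (m := m) B k a b = 0 := fun k : Fin n => by
    rw [genOmega, Matrix.sub_apply, Matrix.neg_apply, posUpper_single _ _ a b hab,
      posUpper_single _ _ a b hab, neg_zero, sub_zero]
    · simp [pos]; omega
    · simp [pos]; omega
  simp [potential, Matrix.sum_apply, h1, h2, h3]

lemma dvdX_scaled {A : Mat m n B} (h : PosUpper A) : DvdX 1 (scaled A) := by
  intro a b
  by_cases hab : pos b < pos a
  · simp [scaled, h a b hab]
  · exact Dvd.dvd.mul_right (pow_dvd_pow _ (by omega)) _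

end Normalized

/-! ### Weights of differential polynomials -/

section Weights

open MvPolynomial

variable {m n : ℕ}

/-- The derivative of a letter. -/
def Letter.succ : Letter m n → Letter m n
  | .q i k => .q i (k + 1)
  | .r i k => .r i (k + 1)
  | .u i k => .u i (k + 1)

/-- The weight of a letter, together with its parity in `q` and `r`. -/
def Letter.wt : Letter m n → ℕ × ZMod 2
  | .q _ k => (n + 1 + k, 1)
  | .r _ k => (n + 1 + k, 1)
  | .u i k => (2 * i + 2 + k, 0)

lemma Letter.wt_succ (l : Letter m n) : l.succ.wt = l.wt + (1, 0) := by
  cases l <;> simp [Letter.succ, Letter.wt, add_assoc]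

/-- The derivation `∂_x` of the differential polynomials. -/
def dPoly : Derivation ℂ (MvPolynomial (Letter m n) ℂ) (MvPolynomial (Letter m n) ℂ) :=
  mkDerivation ℂ fun l => X l.succ

lemma dPoly_X (l : Letter m n) : dPoly (X l) = X l.succ := mkDerivation_X _ _ _

/-- By the Leibniz rule each term replaces one letter by its derivative, which is heavier by one and
has the same parity. -/
lemma isWeightedHomogeneous_dPoly {P : MvPolynomial (Letter m n) ℂ} {w : ℕ × ZMod 2}
    (hP : IsWeightedHomogeneous Letter.wt P w) :
    IsWeightedHomogeneous Letter.wt (dPoly P) (w + (1, 0)) := by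
  classical
  rw [P.as_sum, map_sum]
  refine IsWeightedHomogeneous.sum _ _ _ fun s hs => ?_
  rw [dPoly, mkDerivation_monomial, smul_eq_C_mul]
  refine IsWeightedHomogeneous.C_mul ?_ _
  refine IsWeightedHomogeneous.sum _ _ _ fun i hi => ?_
  have hw : Finsupp.weight Letter.wt s = w := hP (mem_support_iff.1 hs)
  have hle : Finsupp.single i 1 ≤ s := by
    rw [Finsupp.single_le_iff]; exact Nat.one_le_iff_ne_zero.2 (Finsupp.mem_support_iff.1 hi)
  have hdec : Finsupp.weight Letter.wt (s - Finsupp.single i 1) + Letter.wt i = w := by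
    rw [← hw]
    nth_rewrite 2 [← tsub_add_cancel_of_le hle]
    rw [map_add, Finsupp.weight_single, one_smul]
  change IsWeightedHomogeneous Letter.wt (monomial _ _ * X i.succ) _
  rw [← hdec, add_assoc, ← Letter.wt_succ]
  exact (isWeightedHomogeneous_monomial _ _ _ rfl).mul (isWeightedHomogeneous_X _ _ _)

/-- The coefficients of `X ^ w` have weight `w` and the parity of their block. -/
def Graded (A : Mat m n (PowerSeries (MvPolynomial (Letter m n) ℂ))) : Prop :=
  ∀ a b w, IsWeightedHomogeneous Letter.wt (PowerSeries.coeff w (A a b)) (w, blk a + blk b)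

namespace Graded

variable {A A' : Mat m n (PowerSeries (MvPolynomial (Letter m n) ℂ))}

lemma add (h : Graded A) (h' : Graded A') : Graded (A + A') := fun a b w => by
  simpa using (h a b w).add (h' a b w)

lemma neg (h : Graded A) : Graded (-A) := fun a b w => by simpa using (h a b w).neg

lemma sub (h : Graded A) (h' : Graded A') : Graded (A - A') := by
  rw [sub_eq_add_neg]; exact h.add h'.neg

lemma sum {ι : Type*} {s : Finset ι}
    {F : ι → Mat m n (PowerSeries (MvPolynomial (Letter m n) ℂ))} (h : ∀ i ∈ s, Graded (F i)) :
    Graded (∑ i ∈ s, F i) := fun a b w => by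
  rw [Matrix.sum_apply, map_sum]
  exact IsWeightedHomogeneous.sum _ _ _ fun i hi => h i hi a b w

lemma mul (h : Graded A) (h' : Graded A') : Graded (A * A') := fun a b w => by
  rw [Matrix.mul_apply, map_sum]
  refine IsWeightedHomogeneous.sum _ _ _ fun c _ => ?_
  rw [PowerSeries.coeff_mul]
  refine IsWeightedHomogeneous.sum _ _ _ fun ij hij => ?_
  have hsum : ((w, blk a + blk b) : ℕ × ZMod 2) =
      (ij.1, blk a + blk c) + (ij.2, blk c + blk b) := by
    have hc : blk c + blk c = 0 := CharTwo.add_self_eq_zero _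
    rw [Prod.mk_add_mk, Finset.HasAntidiagonal.mem_antidiagonal.1 hij,
      show blk a + blk c + (blk c + blk b) = blk a + blk b + (blk c + blk c) by ring, hc, add_zero]
  rw [hsum]
  exact (h a c ij.1).mul (h' c b ij.2)

lemma smul (c : ℂ) (h : Graded A) : Graded (c • A) := fun a b w => by
  have : PowerSeries.coeff w ((c • A) a b) = C c * PowerSeries.coeff w (A a b) := by
    simp [smul_eq_C_mul]
  rw [this]
  exact (h a b w).C_mul c

lemma one : Graded (1 : Mat m n (PowerSeries (MvPolynomial (Letter m n) ℂ))) := fun a b w => by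
  rw [Matrix.one_apply]
  split_ifs with hab
  · subst hab
    have hc : blk a + blk a = 0 := CharTwo.add_self_eq_zero _
    rw [hc, PowerSeries.coeff_one]
    split_ifs with hw
    · subst hw; exact isWeightedHomogeneous_one _ _
    · exact isWeightedHomogeneous_zero _ _ _
  · simpa using isWeightedHomogeneous_zero _ _ _

lemma pow (h : Graded A) (k : ℕ) : Graded (A ^ k) := by
  induction k with
  | zero => rw [pow_zero]; exact one
  | succ k ih => rw [pow_succ]; exact ih.mul h

lemma cyc : Graded (cyc m n (PowerSeries (MvPolynomial (Letter m n) ℂ))) := by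
  intro a b w
  rcases a with a | a <;> rcases b with b | b
  iterate 3 simpa [CCKP.cyc] using isWeightedHomogeneous_zero _ _ _
  simp only [CCKP.cyc, fromBlocks_apply₂₂, shift, Matrix.of_apply, blk, add_zero]
  split_ifs
  · rw [PowerSeries.coeff_one]
    split_ifs with hw
    · subst hw; exact isWeightedHomogeneous_one _ _
    · exact isWeightedHomogeneous_zero _ _ _
  · simpa using isWeightedHomogeneous_zero _ _ _

/-- The factor X compensates for the unit of weight added by the derivation. -/
lemma X_smul_coeffwise (h : Graded A) :
    Graded ((PowerSeries.X : PowerSeries (MvPolynomial (Letter m n) ℂ)) •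
      A.map (coeffwise dPoly)) := by
  intro a b w
  rw [Matrix.smul_apply, smul_eq_mul, Matrix.map_apply]
  cases w with
  | zero => simpa using isWeightedHomogeneous_zero _ _ _
  | succ w =>
    rw [PowerSeries.coeff_succ_X_mul, coeff_coeffwise]
    simpa using isWeightedHomogeneous_dPoly (h a b w)

lemma scaled_single {i j : Idx m n} {c : MvPolynomial (Letter m n) ℂ}
    (hc : IsWeightedHomogeneous Letter.wt c (pos j + 1 - pos i, blk i + blk j)) :
    Graded (scaled (single i j c)) := by
  intro a b w
  rw [CCKP.scaled_single, Matrix.single_apply]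
  split_ifs with h
  · rw [← h.1, ← h.2, PowerSeries.coeff_X_pow_mul']
    split_ifs with hw
    · rw [PowerSeries.coeff_C]
      split_ifs with hw'
      · rwa [show w = pos j + 1 - pos i by omega]
      · exact isWeightedHomogeneous_zero _ _ _
    · exact isWeightedHomogeneous_zero _ _ _
  · simpa using isWeightedHomogeneous_zero _ _ _

lemma step {k : ℕ} {Λ U σ : Mat m n (PowerSeries (MvPolynomial (Letter m n) ℂ))} (hΛ : Graded Λ)
    (hU : Graded U) (hσ : Graded σ) : Graded (step k dPoly Λ U σ) := by
  refine hΛ.add (mul (sub (add (smul _ (hΛ.pow _)) (hΛ.pow _)) one) (sub (sum fun i _ => ?_)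
    (sum fun i _ => ?_)))
  · refine (hΛ.pow _).mul (sum fun i _ => ((hΛ.pow _).mul ?_).mul (hΛ.pow _))
    exact (hσ.X_smul_coeffwise.add ((hU.mul hσ).sub (hσ.mul hU))).neg
  · exact (((hσ.pow _).sub (hΛ.pow _)).mul (hσ.sub hΛ)).mul (hΛ.pow _)

end Graded

/-- The generic potential. -/
def genericPotential (m n : ℕ) : Mat m n (MvPolynomial (Letter m n) ℂ) :=
  potential (fun i => X (.q i 0)) (fun i => X (.r i 0)) (fun i => X (.u i 0))

/-- The weights of the letters are chosen for this: each equals the exponent of X that `scaled`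
attaches to the entries containing the letter, and q, r sit exactly in the off-diagonal blocks. -/
lemma graded_scaled_genericPotential : Graded (scaled (genericPotential m n)) := by
  have key : ∀ (i j : Idx m n) (l : Letter m n) (k : ℕ),
      l.wt = (pos j + 1 - pos i, blk i + blk j) →
      Graded (scaled (single i j (X l * (-1) ^ k))) := by
    intro i j l k hl
    refine Graded.scaled_single ?_
    have : ((-1) ^ k : MvPolynomial (Letter m n) ℂ) = C ((-1) ^ k) := by simp
    rw [this, mul_comm, ← hl]
    exact (isWeightedHomogeneous_X _ _ _).C_mul _
  have key' : ∀ (i j : Idx m n) (l : Letter m n),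
      l.wt = (pos j + 1 - pos i, blk i + blk j) →
      Graded (scaled (single i j (X l * (1 : MvPolynomial (Letter m n) ℂ)))) := by
    intro i j l hl
    have := key i j l 0 hl
    rwa [pow_zero] at this
  rw [genericPotential, potential, scaled_add, scaled_add, scaled_sum, scaled_sum, scaled_sum]
  refine ((Graded.sum fun i _ => ?_).add (Graded.sum fun i _ => ?_)).add (Graded.sum fun k _ => ?_)
  · rw [genMu, smul_add, Matrix.smul_single, Matrix.smul_single, smul_eq_mul, smul_eq_mul,
      scaled_add]
    refine (key' _ _ _ ?_).add (key _ _ _ _ ?_)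
    · simp [pos, blk, Letter.wt]; omega
    · simp [pos, blk, Letter.wt]
  · rw [genNu, smul_sub, Matrix.smul_single, Matrix.smul_single, smul_eq_mul, smul_eq_mul,
      sub_eq_add_neg, scaled_add, scaled_neg]
    refine (key _ _ _ _ ?_).add (key' _ _ _ ?_).neg
    · simp [pos, blk, Letter.wt]; omega
    · simp [pos, blk, Letter.wt]
  · rw [genOmega, smul_sub, smul_neg, Matrix.smul_single, Matrix.smul_single, smul_eq_mul,
      sub_eq_add_neg, scaled_add, scaled_neg, scaled_neg]
    refine (key' _ _ _ ?_).neg.add (key' _ _ _ ?_).neg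
    · simp [pos, blk, Letter.wt]; omega
    · simp [pos, blk, Letter.wt]; omega

/-- The differential polynomial that expresses `(ln τ)_{t₁ t_{2k+1}}`. -/
def tauPoly (m n k : ℕ) : MvPolynomial (Letter m n) ℂ :=
  PowerSeries.coeff (2 * k + 2)
    (((step (2 * n + 1) dPoly (cyc m n _) (scaled (genericPotential m n)))^[2 * k + 2]
      (cyc m n _) ^ (2 * k + 1)) (.inr (Fin.last _)) (.inr 0))

lemma isWeightedHomogeneous_tauPoly (k : ℕ) :
    IsWeightedHomogeneous Letter.wt (tauPoly m n k) (2 * k + 2, 0) := by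
  have h : ∀ w, Graded ((step (2 * n + 1) dPoly (cyc m n _)
      (scaled (genericPotential m n)))^[w] (cyc m n _)) := by
    intro w
    induction w with
    | zero => exact Graded.cyc
    | succ w ih =>
      rw [Function.iterate_succ_apply']
      exact Graded.cyc.step graded_scaled_genericPotential ih
  exact (h (2 * k + 2)).pow (2 * k + 1) (.inr (Fin.last _)) (.inr 0) (2 * k + 2)

/-- The one bridge from polynomials to solutions, used both for the actual fields and for the dual
numbers. An error divisible by X^(2k+3) cannot affect the coefficient of X^(2k+2). -/
lemma map_tauPoly {B : Type} [CommRing B] [Algebra ℂ B] {D : B → B}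
    (φ : MvPolynomial (Letter m n) ℂ →ₐ[ℂ] B) (hφ : ∀ P, φ (dPoly P) = D (φ P))
    {σ : Mat m n (PowerSeries B)} (h₀ : DvdX 1 (σ - cyc m n _))
    (hσ : σ ^ (2 * n + 1 + 1) = σ)
    (hD : (PowerSeries.X : PowerSeries B) • σ.map (coeffwise D) +
      ((cyc m n _ + scaled (φ.toRingHom.mapMatrix (genericPotential m n))) * σ -
        σ * (cyc m n _ + scaled (φ.toRingHom.mapMatrix (genericPotential m n)))) = 0) (k : ℕ) :
    φ (tauPoly m n k) =
      PowerSeries.coeff (2 * k + 2) ((σ ^ (2 * k + 1)) (.inr (Fin.last _)) (.inr 0)) := by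
  have hup : PosUpper (φ.toRingHom.mapMatrix (genericPotential m n)) := by
    rw [genericPotential, map_potential]; exact posUpper_potential _ _ _
  have hfix := step_eq_self (k := 2 * n + 1) (Nat.succ_ne_zero _) (Λ := cyc m n (PowerSeries B))
    (cyc_pow_card_succ) hσ hD
  have hsub := DvdX.sub_iterate_step
    (dvdX_scaled hup) h₀ hfix (2 * k + 2)
  rw [(hsub.pow_sub_pow (2 * k + 1)).coeff_eq (by omega)]
  have hmap := map_iterate_step φ hφ (2 * n + 1) (cyc m n _) (scaled (genericPotential m n))
    (2 * k + 2)
  rw [map_cyc, map_scaled] at hmap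
  rw [← hmap, ← map_pow, RingHom.mapMatrix_apply, Matrix.map_apply, PowerSeries.coeff_map]
  rfl

end Weights

end

end CCKP

namespace CCKP

noncomputable section

/-! ### The linear coefficient -/

section Average

variable {A : Type*} [Ring A]

lemma powSum_sub_right (x y d d' : A) (k : ℕ) :
    powSum x y (d - d') k = powSum x y d k - powSum x y d' k := by
  simp [powSum, mul_sub, sub_mul, Finset.sum_sub_distrib]

lemma mul_powSum (x y d : A) (k : ℕ) : x * powSum x y d k = powSum x y (x * d) k := by
  simp only [powSum, Finset.mul_sum]
  refine Finset.sum_congr rfl fun i _ => ?_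
  rw [← mul_assoc, ← mul_assoc, ← pow_succ', pow_succ, mul_assoc (x ^ i)]

lemma powSum_mul (x y d : A) (k : ℕ) : powSum x y d k * y = powSum x y (d * y) k := by
  simp only [powSum, Finset.sum_mul]
  refine Finset.sum_congr rfl fun i _ => ?_
  rw [mul_assoc, ← pow_succ, pow_succ', mul_assoc, mul_assoc, mul_assoc]

lemma powSum_of_commute {x d : A} (h : x * d = d * x) (k : ℕ) :
    powSum x x d (k + 1) = ((k : A) + 1) * (d * x ^ k) := by
  have hp : ∀ i, x ^ i * d = d * x ^ i := fun i => ((show Commute x d from h).pow_left i).eq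
  have : ((k : A) + 1) * (d * x ^ k) = ∑ i ∈ Finset.range (k + 1), d * x ^ k := by
    simp [add_mul]
  rw [this, powSum]
  refine Finset.sum_congr rfl fun i hi => ?_
  rw [hp, mul_assoc, ← pow_add, show i + (k + 1 - 1 - i) = k by
    have := Finset.mem_range.1 hi; omega]

/-- The commutator telescopes to Λ^N ωΛ - ωΛ Λ^N, and both terms equal ωΛ. -/
lemma commute_powSum {N : ℕ} {Λ ω : A} (h₁ : Λ ^ N * ω = ω) (h₂ : ω * Λ ^ N = ω) :
    Λ * powSum Λ Λ (ω * Λ) N = powSum Λ Λ (ω * Λ) N * Λ := by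
  have h := powSum_commutator Λ Λ (ω * Λ) N
  rw [powSum_sub_right, ← mul_powSum, ← powSum_mul Λ Λ (ω * Λ)] at h
  refine sub_eq_zero.1 (h.trans ?_)
  rw [← mul_assoc, h₁, mul_assoc ω, ← pow_succ', pow_succ, ← mul_assoc, h₂, sub_self]

variable [Algebra ℂ A]

/-- The average of `ω` under conjugation by the powers of `Λ`, where `Λ ^ N` fixes `ω`. -/
def average (N : ℕ) (Λ ω : A) : A := (N : ℂ)⁻¹ • powSum Λ Λ (ω * Λ) N

lemma commute_average {N : ℕ} {Λ ω : A} (h₁ : Λ ^ N * ω = ω) (h₂ : ω * Λ ^ N = ω) :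
    Λ * average N Λ ω = average N Λ ω * Λ := by
  rw [average, mul_smul_comm, smul_mul_assoc, commute_powSum h₁ h₂]

/-- The linearized identity σ^(N+1) = σ: the sum for ω is N times the average plus ω, and the sum
for the average is N+1 times itself. -/
lemma powSum_sub_average {N : ℕ} (hN : N ≠ 0) {Λ ω : A} (h₁ : Λ ^ N * ω = ω)
    (h₂ : ω * Λ ^ N = ω) :
    powSum Λ Λ (ω - average N Λ ω) (N + 1) = ω - average N Λ ω := by
  have hN' : (N : ℂ) ≠ 0 := by exact_mod_cast hN
  have e1 : powSum Λ Λ (ω * Λ) N = (N : A) * average N Λ ω := by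
    have : (N : A) = algebraMap ℂ A N := by simp
    rw [average, this, ← Algebra.smul_def, smul_smul, mul_inv_cancel₀ hN', one_smul]
  have e2 : average N Λ ω * Λ ^ N = average N Λ ω := by
    rw [average, smul_mul_assoc]
    congr 1
    simp only [powSum, Finset.sum_mul]
    refine Finset.sum_congr rfl fun i _ => ?_
    rw [mul_assoc, ← pow_add, add_comm, pow_add, ← mul_assoc, mul_assoc (Λ ^ i), mul_assoc ω,
      ← pow_succ', pow_succ, ← mul_assoc ω, h₂]
  rw [powSum_sub_right, powSum_succ, powSum_mul, e1, h₁, powSum_of_commute (commute_average h₁ h₂),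
    e2]
  noncomm_ring

lemma add_smul_pow {R : Type*} [CommRing R] {A : Type*} [Ring A] [Algebra R A] {e : R}
    (he : e * e = 0) (Λ s : A) (k : ℕ) : (Λ + e • s) ^ k = Λ ^ k + e • powSum Λ Λ s k := by
  induction k with
  | zero => simp [powSum]
  | succ k ih =>
    rw [pow_succ, ih, powSum_succ, pow_succ, mul_add, add_mul, add_mul, smul_mul_smul_comm, he,
      zero_smul, add_zero, smul_add, smul_mul_assoc, mul_smul_comm, add_assoc]

end Average

/-! ### Corner entries of products of ω with cyclic shifts -/

section Entries

variable {m n : ℕ} {R : Type} [CommRing R]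

lemma mul_single_mul_apply (A A' : Mat m n R) (i j a b : Idx m n) :
    (A * single i j 1 * A' : Mat m n R) a b = A a i * A' j b := by
  rw [Matrix.mul_assoc, Matrix.mul_apply, Finset.sum_eq_single i]
  · simp
  · intro c _ hc
    simp [Matrix.single_mul_apply_of_ne _ _ _ _ _ hc]
  · simp

lemma cyc_mul_genOmega_mul_cyc (k : Fin n) (c d : ℕ) :
    (cyc m n R ^ c * genOmega R k * cyc m n R ^ d : Mat m n R) (.inr (Fin.last _)) (.inr 0) =
      -((if 2 * n = (n - 1 - k + c) % (2 * n + 1) then 1 else 0) *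
          (if n + k = d % (2 * n + 1) then 1 else 0))
      - ((if 2 * n = (n - k + c) % (2 * n + 1) then 1 else 0) *
          (if n + k + 1 = d % (2 * n + 1) then 1 else 0)) := by
  rw [genOmega, mul_sub, sub_mul, mul_neg, neg_mul, Matrix.sub_apply, Matrix.neg_apply,
    mul_single_mul_apply, mul_single_mul_apply, cyc_pow_inr_inr, cyc_pow_inr_inr, cyc_pow_inr_inr,
    cyc_pow_inr_inr]
  simp

lemma proj_mul_genOmega (k : Fin n) : proj m n R * genOmega R k = genOmega R k := by
  have h : ∀ a b c, proj m n R * single (.inr a) (.inr b) c = single (.inr a) (.inr b) c := by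
    intro a b c
    rw [proj]
    ext x y
    rw [Matrix.mul_apply, Finset.sum_eq_single (.inr a)]
    · rcases x with x | x
      · simp [Matrix.single_apply]
      · simp only [fromBlocks_apply₂₂, Matrix.one_apply, Matrix.single_apply, Sum.inr.injEq]
        by_cases hx : x = a
        · simp [hx]
        · simp [hx, Ne.symm hx]
    · intro z _ hz; simp [hz.symm]
    · simp
  rw [genOmega, mul_sub, mul_neg, h, h]

lemma genOmega_mul_proj (k : Fin n) : genOmega R k * proj m n R = genOmega R k := by
  have h : ∀ a b c, single (.inr a) (.inr b) c * proj m n R = single (.inr a) (.inr b) c := by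
    intro a b c
    rw [proj]
    ext x y
    rw [Matrix.mul_apply, Finset.sum_eq_single (.inr b)]
    · rcases y with y | y
      · simp [Matrix.single_apply]
      · simp only [fromBlocks_apply₂₂, Matrix.one_apply, Matrix.single_apply, Sum.inr.injEq]
        by_cases hx : b = y
        · simp [hx]
        · simp [hx]
    · intro z _ hz; simp [hz.symm]
    · simp
  rw [genOmega, sub_mul, neg_mul, h, h]

variable [Algebra ℂ R]

/-- A unit of ω reaches the corner only after n+k+1 or n+k shifts on the left and n+k or n+k+1 on
the right, 2n+1+2k in all. The sum for ω has 2k shifts per term and contributes nothing. In the sum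
for the average each of the two units occurs once, with sign -1, and the minus sign in front of the
average makes the result positive. -/
lemma powSum_average_apply (k : Fin n) :
    powSum (cyc m n R) (cyc m n R)
      (genOmega R k - average (2 * n + 1) (cyc m n R) (genOmega R k)) (2 * k + 1)
      (.inr (Fin.last _)) (.inr 0) =
      algebraMap ℂ R ((2 * (2 * (k : ℂ) + 1)) / (2 * (n : ℂ) + 1)) := by
  have hk := k.2
  have h₁ : cyc m n R ^ (2 * n + 1) * genOmega R k = genOmega R k := by
    rw [cyc_pow_card, proj_mul_genOmega]
  have h₂ : genOmega R k * cyc m n R ^ (2 * n + 1) = genOmega R k := by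
    rw [cyc_pow_card, genOmega_mul_proj]
  have hcomm := commute_average h₁ h₂
  have hz : powSum (cyc m n R) (cyc m n R) (genOmega R k) (2 * k + 1) (.inr (Fin.last _)) (.inr 0)
      = 0 := by
    rw [powSum, Matrix.sum_apply]
    refine Finset.sum_eq_zero fun c hc => ?_
    have hc' := Finset.mem_range.1 hc
    rw [cyc_mul_genOmega_mul_cyc, Nat.mod_eq_of_lt (by omega), Nat.mod_eq_of_lt (by omega),
      if_neg (by omega), if_neg (by omega)]
    simp
    omega
  have hcp : cyc m n R ^ (2 * (k : ℕ)) * average (2 * n + 1) (cyc m n R) (genOmega R k) =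
      average (2 * n + 1) (cyc m n R) (genOmega R k) * cyc m n R ^ (2 * (k : ℕ)) :=
    ((show Commute _ _ from hcomm).pow_left _).eq
  -- The shifts now total 2n+1+2k, so each of the two units of ω meets the corner for exactly one i.
  have hs : (∑ i ∈ Finset.range (2 * n + 1),
      (cyc m n R ^ (2 * (k : ℕ) + i) * genOmega R k * cyc m n R ^ (2 * n + 1 - i) : Mat m n R)
        (.inr (Fin.last _)) (.inr 0)) = -2 := by
    have e : ∀ i ∈ Finset.range (2 * n + 1),
        (cyc m n R ^ (2 * (k : ℕ) + i) * genOmega R k * cyc m n R ^ (2 * n + 1 - i) : Mat m n R)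
        (.inr (Fin.last _)) (.inr 0) =
        -(if i = n + 1 - k then 1 else 0) - (if i = n - k then 1 else 0) := by
      intro i hi
      have hi' := Finset.mem_range.1 hi
      rw [cyc_mul_genOmega_mul_cyc]
      congr 2
      · by_cases h : i = n + 1 - k
        · rw [if_pos h, if_pos, if_pos, mul_one]
          · rw [Nat.mod_eq_of_lt (by omega)]; omega
          · rw [Nat.mod_eq_of_lt (by omega)]; omega
        · rw [if_neg h]
          refine mul_eq_zero_of_right _ (if_neg ?_)
          -- For i = 0 the right exponent 2n+1 wraps around to 0.
          rcases Nat.eq_zero_or_pos i with rfl | hpos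
          · simp; omega
          · rw [Nat.mod_eq_of_lt (by omega)]; omega
      · by_cases h : i = n - k
        · rw [if_pos h, if_pos, if_pos, mul_one]
          · rw [Nat.mod_eq_of_lt (by omega)]; omega
          · rw [Nat.mod_eq_of_lt (by omega)]; omega
        · rw [if_neg h]
          refine mul_eq_zero_of_right _ (if_neg ?_)
          rcases Nat.eq_zero_or_pos i with rfl | hpos
          · simp
          · rw [Nat.mod_eq_of_lt (by omega)]; omega
    rw [Finset.sum_congr rfl e, Finset.sum_sub_distrib, Finset.sum_neg_distrib,
      Finset.sum_ite_eq', Finset.sum_ite_eq', if_pos (Finset.mem_range.2 (by omega)),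
      if_pos (Finset.mem_range.2 (by omega))]
    norm_num
  have ha : (cyc m n R ^ (2 * (k : ℕ)) * average (2 * n + 1) (cyc m n R) (genOmega R k))
      (.inr (Fin.last _)) (.inr 0) = (((2 * n + 1 : ℕ) : ℂ)⁻¹) • (-2 : R) := by
    rw [average, mul_smul_comm, Matrix.smul_apply, ← hs, powSum, Finset.mul_sum, Matrix.sum_apply]
    congr 1
    refine Finset.sum_congr rfl fun i hi => ?_
    have hi' := Finset.mem_range.1 hi
    rw [pow_add, show 2 * n + 1 - i = (2 * n + 1 - 1 - i) + 1 by omega,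
      pow_succ' _ (2 * n + 1 - 1 - i)]
    simp only [mul_assoc]
  rw [powSum_sub_right, Matrix.sub_apply, hz, zero_sub, powSum_of_commute hcomm, ← hcp]
  have hcast : (((2 * (k : ℕ) : ℕ) : Mat m n R) + 1) =
      ((2 * (k : ℂ) + 1) • (1 : Mat m n R)) := by
    have : ((2 * (k : ℂ) + 1)) = ((2 * (k : ℕ) + 1 : ℕ) : ℂ) := by push_cast; ring
    rw [this, Nat.cast_smul_eq_nsmul, nsmul_eq_mul, mul_one]; push_cast; rfl
  rw [hcast, smul_mul_assoc, one_mul, Matrix.smul_apply, ha]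
  have h2 : (-2 : R) = algebraMap ℂ R (-2) := by rw [map_neg, map_ofNat]
  rw [h2, Algebra.smul_def, Algebra.smul_def, ← map_mul, ← map_mul, ← map_neg]
  congr 1
  push_cast
  field_simp

end Entries

/-! ### The coefficient of the leading u, computed over the dual numbers -/

section Linear

open MvPolynomial

variable {m n : ℕ}

open Classical in
/-- The value at the infinitesimal point where only the letter `l` is nonzero. -/
def dualPoint (l : Letter m n) : MvPolynomial (Letter m n) ℂ →ₐ[ℂ] DualNumber ℂ :=
  aeval fun l' => if l' = l then DualNumber.eps else 0

lemma dualPoint_eq (l : Letter m n) (P : MvPolynomial (Letter m n) ℂ) :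
    (dualPoint l P).fst = coeff 0 P ∧ (dualPoint l P).snd = coeff (Finsupp.single l 1) P := by
  classical
  induction P using MvPolynomial.induction_on with
  | C a =>
    have : dualPoint l (C a) = algebraMap ℂ (DualNumber ℂ) a := by
      rw [dualPoint, MvPolynomial.aeval_C]
    rw [this, coeff_C, coeff_C, if_pos rfl, if_neg (by simp [eq_comm])]
    exact ⟨rfl, rfl⟩
  | add p q hp hq => simp [hp, hq]
  | mul_X p l' hp =>
    have hX : dualPoint l (X l') = if l' = l then DualNumber.eps else 0 := by
      simp [dualPoint]
    rw [map_mul, hX, coeff_mul_X', coeff_mul_X']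
    by_cases h : l' = l
    · subst h
      simp [hp.1]
    · simp [h]

/-- Every term of a derivative contains a letter of positive order, and the point is zero on those.
The derivation on the dual numbers may thus be taken to be 0. -/
lemma dualPoint_dPoly (j : Fin n) (P : MvPolynomial (Letter m n) ℂ) :
    dualPoint (.u j 0) (dPoly P) = 0 := by
  induction P using MvPolynomial.induction_on with
  | C a => simp [dPoly]
  | add p q hp hq => simp [hp, hq]
  | mul_X p l hp =>
    have hX : dualPoint (.u j 0 : Letter m n) (X l.succ) = 0 := by
      cases l <;> simp [dualPoint, Letter.succ]
    rw [Derivation.leibniz, dPoly_X, smul_eq_mul, smul_eq_mul, map_add, map_mul, map_mul, hX, hp]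
    simp

lemma coeff_tauPoly (j : Fin n) :
    coeff (Finsupp.single (.u j 0) 1) (tauPoly m n j) =
      (2 * (2 * (j : ℂ) + 1)) / (2 * (n : ℂ) + 1) := by
  classical
  rw [← (dualPoint_eq _ _).2]
  -- Both units of ω raise `pos` by 2j+1 and the scaling adds one, hence the exponent 2j+2.
  set e : PowerSeries (DualNumber ℂ) := PowerSeries.X ^ (2 * (j : ℕ) + 2) *
    PowerSeries.C (DualNumber.eps : DualNumber ℂ) with he
  have hee : e * e = 0 := by
    rw [he, mul_mul_mul_comm, ← map_mul, DualNumber.eps_mul_eps]; simp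
  set Λ := cyc m n (PowerSeries (DualNumber ℂ)) with hΛ
  set ω : Mat m n (PowerSeries (DualNumber ℂ)) := genOmega _ j with hω
  set s := ω - average (2 * n + 1) Λ ω with hs
  have h₁ : Λ ^ (2 * n + 1) * ω = ω := by rw [hΛ, cyc_pow_card, hω, proj_mul_genOmega]
  have h₂ : ω * Λ ^ (2 * n + 1) = ω := by rw [hΛ, cyc_pow_card, hω, genOmega_mul_proj]
  have hU : scaled ((dualPoint (.u j 0)).toRingHom.mapMatrix (genericPotential m n)) = e • ω := by
    rw [genericPotential, map_potential]
    have hq : (⇑(dualPoint (.u j 0 : Letter m n)).toRingHom ∘ fun i => X (.q i 0)) =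
        fun _ => 0 := by funext i; simp [dualPoint]
    have hr : (⇑(dualPoint (.u j 0 : Letter m n)).toRingHom ∘ fun i => X (.r i 0)) =
        fun _ => 0 := by funext i; simp [dualPoint]
    have hu : (⇑(dualPoint (.u j 0 : Letter m n)).toRingHom ∘ fun i => X (.u i 0)) =
        fun i => if i = j then DualNumber.eps else 0 := by funext i; simp [dualPoint]
    rw [hq, hr, hu, potential]
    simp only [zero_smul, Finset.sum_const_zero, zero_add, ite_smul, Finset.sum_ite_eq',
      Finset.mem_univ, if_true]
    rw [hω, genOmega, genOmega, smul_sub, smul_neg, smul_sub, smul_neg, Matrix.smul_single,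
      Matrix.smul_single, Matrix.smul_single, Matrix.smul_single, sub_eq_add_neg, scaled_add,
      scaled_neg, scaled_neg, scaled_single, scaled_single, he]
    have hj := j.2
    have p1 : n + (j : ℕ) + 1 - (n - 1 - j) = 2 * j + 2 := by omega
    have p2 : n + (j : ℕ) + 1 + 1 - (n - j) = 2 * j + 2 := by omega
    simp only [pos, p1, p2, smul_eq_mul, mul_one, sub_eq_add_neg]
  -- The ansatz Λ + e s needs [Λ, s] = [Λ, ω] and the linearized power identity. Removing from ω its
  -- average, which commutes with Λ, achieves both.
  have hsig := map_tauPoly (D := fun _ => 0) (dualPoint (.u j 0)) (dualPoint_dPoly j)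
    (σ := Λ + e • s) ?_ ?_ ?_ (j : ℕ)
  · rw [hsig, add_smul_pow hee, Matrix.add_apply, hΛ, cyc_pow_inr_inr, Matrix.smul_apply, hs,
      powSum_average_apply, if_neg, zero_add, he, smul_eq_mul, mul_assoc,
      PowerSeries.coeff_X_pow_mul', if_pos le_rfl, Nat.sub_self, mul_comm]
    · rw [PowerSeries.coeff_mul_C]
      simp [PowerSeries.algebraMap_apply, TrivSqZeroExt.algebraMap_eq_inl]
    · have hj := j.2
      rw [Nat.mod_eq_of_lt (by simp)]
      simp
      omega
  · rw [add_sub_cancel_left]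
    intro a b
    rw [pow_one, Matrix.smul_apply, he, smul_eq_mul, mul_assoc, pow_succ', mul_assoc]
    exact dvd_mul_right _ _
  · rw [add_smul_pow hee, hΛ, cyc_pow_card_succ, hs, powSum_sub_average (by omega) h₁ h₂]
  · rw [hU]
    have hz : (Λ + e • s).map (coeffwise fun _ => (0 : DualNumber ℂ)) = 0 := by
      ext1 a b; ext1 i; simp
    rw [hz, smul_zero, zero_add]
    have hc := commute_average h₁ h₂
    have : (Λ + e • ω) * (Λ + e • s) - (Λ + e • s) * (Λ + e • ω) =
        e • (Λ * s - s * Λ + ω * Λ - Λ * ω) + (e * e) • (ω * s - s * ω) := by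
      simp only [mul_add, add_mul, smul_mul_assoc, mul_smul_comm, smul_sub, smul_add, smul_smul]
      abel
    rw [this, hee, zero_smul, add_zero, hs, mul_sub, sub_mul, hc]
    rw [show Λ * ω - average (2 * n + 1) Λ ω * Λ - (ω * Λ - average (2 * n + 1) Λ ω * Λ) +
      ω * Λ - Λ * ω = 0 by abel, smul_zero]

/-! ### The variables of the differential polynomials -/

lemma weight_fst_le {P : MvPolynomial (Letter m n) ℂ} {w : ℕ × ZMod 2}
    (hP : IsWeightedHomogeneous Letter.wt P w) {s : Letter m n →₀ ℕ} (hs : s ∈ P.support)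
    {l : Letter m n} (hl : l ∈ s.support) :
    ∃ s' : Letter m n →₀ ℕ, s = s' + Finsupp.single l 1 ∧
      (Finsupp.weight Letter.wt s') + l.wt = w := by
  classical
  have hle : Finsupp.single l 1 ≤ s := by
    rw [Finsupp.single_le_iff]; exact Nat.one_le_iff_ne_zero.2 (Finsupp.mem_support_iff.1 hl)
  refine ⟨s - Finsupp.single l 1, (tsub_add_cancel_of_le hle).symm, ?_⟩
  rw [← hP (mem_support_iff.1 hs)]
  nth_rewrite 2 [← tsub_add_cancel_of_le hle]
  rw [map_add, Finsupp.weight_single, one_smul]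

/-- An odd monomial contains some `q` or `r`. -/
lemma le_weight_of_odd (s : Letter m n →₀ ℕ) (h : (Finsupp.weight Letter.wt s).2 = 1) :
    n + 1 ≤ (Finsupp.weight Letter.wt s).1 := by
  classical
  induction s using Finsupp.induction with
  | zero => simp at h
  | single_add l k s hl hk ih =>
    rw [map_add, Finsupp.weight_single] at h ⊢
    have hk' : 1 ≤ k := Nat.one_le_iff_ne_zero.2 hk
    cases l with
    | q i d =>
      have : n + 1 ≤ (k • (Letter.wt (.q i d : Letter m n))).1 := by
        simp only [Letter.wt, Prod.smul_mk, smul_eq_mul]; nlinarith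
      exact this.trans (by simp)
    | r i d =>
      have : n + 1 ≤ (k • (Letter.wt (.r i d : Letter m n))).1 := by
        simp only [Letter.wt, Prod.smul_mk, smul_eq_mul]; nlinarith
      exact this.trans (by simp)
    | u i d =>
      have h2 : (Finsupp.weight Letter.wt s).2 = 1 := by
        simpa [Letter.wt] using h
      exact (ih h2).trans (by simp)

/-- Removing one odd letter from an even monomial leaves an odd one, which still contains some q or
r and weighs at least n+1. -/
lemma le_of_qr_mem {P : MvPolynomial (Letter m n) ℂ} {w : ℕ}
    (hP : IsWeightedHomogeneous Letter.wt P (w, 0)) {s : Letter m n →₀ ℕ} (hs : s ∈ P.support)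
    {l : Letter m n} (hl : l ∈ s.support) {k : ℕ} (hw : l.wt = (n + 1 + k, 1)) :
    2 * n + 2 + k ≤ w := by
  obtain ⟨s', -, h⟩ := weight_fst_le hP hs hl
  rw [hw] at h
  have h1 : (Finsupp.weight Letter.wt s').1 + (n + 1 + k) = w := congrArg Prod.fst h
  have h2 : (Finsupp.weight Letter.wt s').2 + 1 = 0 := congrArg Prod.snd h
  have h3 : (Finsupp.weight Letter.wt s').2 = 1 := by
    have : (1 : ZMod 2) + 1 = 0 := by decide
    exact add_right_cancel (h2.trans this.symm)
  have := le_weight_of_odd s' h3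
  omega

lemma qrOrderLE_of_homogeneous {P : MvPolynomial (Letter m n) ℂ} {d : ℕ}
    (hP : IsWeightedHomogeneous Letter.wt P (2 * n + 2 + d, 0)) : QROrderLE d P := by
  intro l hl i k hk
  rw [mem_vars_iff_mem_support] at hl
  obtain ⟨s, hs, hls⟩ := hl
  have hw : l.wt = (n + 1 + k, 1) := by
    rcases hk with rfl | rfl <;> rfl
  have := le_of_qr_mem hP hs hls hw
  omega

lemma involvesOnlyULt_sub {P : MvPolynomial (Letter m n) ℂ} {j : Fin n} {c : ℂ}
    (hP : IsWeightedHomogeneous Letter.wt P (2 * j + 2, 0))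
    (hc : coeff (Finsupp.single (.u j 0) 1) P = c) :
    InvolvesOnlyULt j (P - C c * X (.u j 0)) := by
  classical
  have hj := j.2
  have hQ : IsWeightedHomogeneous Letter.wt (P - C c * X (.u j 0)) (2 * j + 2, 0) := by
    refine hP.sub (IsWeightedHomogeneous.C_mul ?_ _)
    exact isWeightedHomogeneous_X ℂ Letter.wt (.u j 0)
  intro l hl
  rw [mem_vars_iff_mem_support] at hl
  obtain ⟨s, hs, hls⟩ := hl
  cases l with
  | q i k => have := le_of_qr_mem hQ hs hls (k := k) rfl; omega
  | r i k => have := le_of_qr_mem hQ hs hls (k := k) rfl; omega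
  | u i k =>
    refine ⟨i, k, ?_, rfl⟩
    obtain ⟨s', hs', h⟩ := weight_fst_le hQ hs hls
    have h1 : (Finsupp.weight Letter.wt s').1 + (2 * i + 2 + k) = 2 * j + 2 := congrArg Prod.fst h
    -- If i ≥ j, the weight 2j+2 is already exhausted by the letter u_j, so the monomial is u_j
    -- itself, whose coefficient has been subtracted.
    by_contra hlt
    have hi : i = j := Fin.ext (by omega)
    have hk : k = 0 := by omega
    subst hi hk
    have hs0 : s' = 0 := by
      by_contra hne
      obtain ⟨l, hl⟩ := Finsupp.support_nonempty_iff.2 hne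
      have hle : (Letter.wt l).1 ≤ (Finsupp.weight Letter.wt s').1 := by
        have hle : Finsupp.single l 1 ≤ s' := by
          rw [Finsupp.single_le_iff]
          exact Nat.one_le_iff_ne_zero.2 (Finsupp.mem_support_iff.1 hl)
        rw [← tsub_add_cancel_of_le hle, map_add, Finsupp.weight_single, one_smul]
        simp
      have hpos : 0 < (Letter.wt l).1 := by cases l <;> simp [Letter.wt]
      omega
    rw [hs0, zero_add] at hs'
    rw [mem_support_iff, hs', coeff_sub, hc, coeff_C_mul, coeff_X, if_pos rfl, mul_one,
      sub_self] at hs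
    exact hs rfl

end Linear

end

end CCKP

namespace CCKP

noncomputable section

/-! ### Calculus of formal loops -/

section Calculus

open MvPowerSeries

/-- The exponents of `λ⁻¹` in `a` lie in `s`. -/
def SuppIn (s : Set ℤ) (a : LFun) : Prop := ∀ α e, e ∉ s → (coeff α a).coeff e = 0

namespace SuppIn

variable {s s' t : Set ℤ} {a b : LFun}

lemma mono (h : SuppIn s a) (hs : s ⊆ t) : SuppIn t a := fun α e he => h α e fun h' => he (hs h')

lemma zero : SuppIn s 0 := fun α e _ => by simp

lemma add (h : SuppIn s a) (h' : SuppIn s b) : SuppIn s (a + b) := fun α e he => by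
  simp [h α e he, h' α e he]

lemma neg (h : SuppIn s a) : SuppIn s (-a) := fun α e he => by simp [h α e he]

lemma sum {ι : Type*} {S : Finset ι} {F : ι → LFun} (h : ∀ i ∈ S, SuppIn s (F i)) :
    SuppIn s (∑ i ∈ S, F i) := fun α e he => by
  rw [map_sum, HahnSeries.coeff_sum]
  exact Finset.sum_eq_zero fun i hi => h i hi α e he

lemma mul (h : SuppIn s a) (h' : SuppIn s' b) (hs : ∀ i ∈ s, ∀ j ∈ s', i + j ∈ t) :
    SuppIn t (a * b) := fun α e he => by
  classical
  rw [coeff_mul, HahnSeries.coeff_sum]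
  refine Finset.sum_eq_zero fun βγ _ => ?_
  rw [HahnSeries.coeff_mul]
  refine Finset.sum_eq_zero fun ij hij => ?_
  rw [Finset.mem_antidiagonal] at hij
  by_cases h1 : ij.1 ∈ s
  · by_cases h2 : ij.2 ∈ s'
    · exact absurd (hij.2.2 ▸ hs _ h1 _ h2) he
    · rw [h' _ _ h2, mul_zero]
  · rw [h _ _ h1, zero_mul]

lemma one (h0 : 0 ∈ s) : SuppIn s 1 := fun α e he => by
  classical
  rw [coeff_one]
  split_ifs
  · rw [HahnSeries.coeff_one, if_neg]
    rintro rfl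
    exact he h0
  · simp

end SuppIn

lemma dtL_add (k : ℕ) (a b : LFun) : dtL k (a + b) = dtL k a + dtL k b := map_add _ _ _

lemma dtL_mul (k : ℕ) (a b : LFun) : dtL k (a * b) = dtL k a * b + a * dtL k b := by
  rw [dtL, Derivation.leibniz, smul_eq_mul, smul_eq_mul, add_comm, mul_comm b]; rfl

lemma coeff_dtL (k : ℕ) (a : LFun) (α : ℕ →₀ ℕ) (e : ℤ) :
    (coeff α (dtL k a)).coeff e = (coeff (α + Finsupp.single k 1) a).coeff e * (α k + 1) := by
  rw [dtL, coeff_pderiv]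
  have : ((α k : LaurentSeries ℂ) + 1) = HahnSeries.C ((α k : ℂ) + 1) := by
    rw [map_add, map_natCast, map_one]
  rw [this, HahnSeries.C_apply, HahnSeries.coeff_mul_single_zero]

lemma SuppIn.dtL {s : Set ℤ} {a : LFun} (h : SuppIn s a) (k : ℕ) : SuppIn s (dtL k a) :=
  fun α e he => by rw [coeff_dtL, h _ _ he, zero_mul]

lemma coeff_dLam₀ (h : LaurentSeries ℂ) (e : ℤ) :
    (dLam₀ h).coeff e = -((e - 1 : ℤ) : ℂ) * h.coeff (e - 1) := by
  rw [dLam₀, HahnSeries.coeff_neg, HahnSeries.coeff_single_mul, one_mul,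
    LaurentSeries.hasseDeriv_coeff, Ring.choose_one_right]
  simp only [Nat.cast_one, zsmul_eq_mul, neg_mul, show e - 2 + 1 = e - 1 by ring]

lemma coeff_dLam (a : LFun) (α : ℕ →₀ ℕ) (e : ℤ) :
    (coeff α (dLam a)).coeff e = -((e - 1 : ℤ) : ℂ) * (coeff α a).coeff (e - 1) :=
  coeff_dLam₀ _ _

lemma dLam₀_add (a b : LaurentSeries ℂ) : dLam₀ (a + b) = dLam₀ a + dLam₀ b := by
  ext e; simp only [coeff_dLam₀, HahnSeries.coeff_add]; ring

lemma dLam₀_mul (a b : LaurentSeries ℂ) : dLam₀ (a * b) = dLam₀ a * b + a * dLam₀ b := by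
  -- the Euler operator, a derivation
  let θ : LaurentSeries ℂ → LaurentSeries ℂ := fun h =>
    { coeff := fun e => (e : ℂ) * h.coeff e
      isPWO_support' := h.isPWO_support.mono (by intro e he hc; exact he (by simp [hc])) }
  have hθ : ∀ h e, (θ h).coeff e = (e : ℂ) * h.coeff e := fun _ _ => rfl
  have hsub : ∀ h, (θ h).support ⊆ h.support := by
    intro h e he hc; exact he (by simp [hθ, hc])
  have hd : ∀ h, dLam₀ h = -(HahnSeries.single 1 1 * θ h) := by
    intro h
    ext e
    rw [coeff_dLam₀, HahnSeries.coeff_neg, HahnSeries.coeff_single_mul, one_mul, hθ, neg_mul]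
  have hm : θ (a * b) = θ a * b + a * θ b := by
    ext e
    rw [hθ, HahnSeries.coeff_add, HahnSeries.coeff_mul,
      HahnSeries.coeff_mul_left' a.isPWO_support (hsub a),
      HahnSeries.coeff_mul_right' b.isPWO_support (hsub b), Finset.mul_sum,
      ← Finset.sum_add_distrib]
    refine Finset.sum_congr rfl fun ij hij => ?_
    rw [Finset.mem_antidiagonal] at hij
    rw [← hij.2.2, hθ, hθ]
    push_cast
    ring
  rw [hd, hd, hd, hm]
  ring

lemma dLam_add (a b : LFun) : dLam (a + b) = dLam a + dLam b := by
  ext1 α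
  exact dLam₀_add _ _

lemma dLam_mul (a b : LFun) : dLam (a * b) = dLam a * b + a * dLam b := by
  classical
  have hs : ∀ (S : Finset ((ℕ →₀ ℕ) × (ℕ →₀ ℕ))) (F : (ℕ →₀ ℕ) × (ℕ →₀ ℕ) → LaurentSeries ℂ),
      dLam₀ (∑ i ∈ S, F i) = ∑ i ∈ S, dLam₀ (F i) := by
    intro S F
    exact map_sum (AddMonoidHom.mk' dLam₀ dLam₀_add) F S
  ext1 α
  rw [map_add, coeff_mul, coeff_mul, ← Finset.sum_add_distrib]
  change dLam₀ (coeff α (a * b)) = _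
  rw [coeff_mul, hs]
  exact Finset.sum_congr rfl fun _ _ => dLam₀_mul _ _

lemma dLam_dtL (k : ℕ) (a : LFun) : dLam (dtL k a) = dtL k (dLam a) := by
  ext1 α
  ext e
  rw [coeff_dLam, coeff_dtL, coeff_dtL, coeff_dLam]
  ring

lemma dLam_ofFun (a : Fun) : dLam (ofFun a) = 0 := by
  ext1 α
  ext e
  rw [coeff_dLam, ofFun, coeff_map, HahnSeries.C_apply, HahnSeries.coeff_single]
  split_ifs with h
  · simp [h]
  · simp

lemma dtL_ofLoop (k : ℕ) (a : LaurentSeries ℂ) : dtL k (ofLoop a) = 0 := pderiv_C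

lemma dLam_ofLoop (a : LaurentSeries ℂ) : dLam (ofLoop a) = ofLoop (dLam₀ a) := by
  classical
  ext1 α
  change dLam₀ (coeff α (C a)) = coeff α (C (dLam₀ a))
  rw [coeff_C, coeff_C]
  split_ifs
  · rfl
  · ext e; simp [coeff_dLam₀]

/-- The constant term is killed, so no λ⁻¹ is ever produced; for a negative loop the derivative
starts at λ⁻². -/
lemma SuppIn.dLam {s : Set ℤ} {a : LFun} (h : SuppIn s a) :
    SuppIn {e | e - 1 ∈ s ∧ e - 1 ≠ 0} (dLam a) := fun α e he => by
  rw [coeff_dLam]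
  by_cases h1 : e - 1 = 0
  · simp [h1]
  · rw [h α (e - 1) fun h2 => he ⟨h2, h1⟩, mul_zero]

lemma coeff_plus (a : LFun) (α : ℕ →₀ ℕ) (e : ℤ) :
    (coeff α (plus a)).coeff e = if e < 1 then (coeff α a).coeff e else 0 := rfl

lemma plus_add (a b : LFun) : plus (a + b) = plus a + plus b := by
  ext1 α; ext e; rw [map_add, HahnSeries.coeff_add, coeff_plus, coeff_plus, coeff_plus]
  split_ifs <;> simp

lemma plus_neg (a : LFun) : plus (-a) = -plus a := by
  ext1 α; ext e; rw [map_neg, HahnSeries.coeff_neg, coeff_plus, coeff_plus]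
  split_ifs <;> simp

lemma plus_eq_self {a : LFun} (h : SuppIn (Set.Iic 0) a) : plus a = a := by
  ext1 α; ext e; rw [coeff_plus]
  split_ifs with he
  · rfl
  · exact (h α e (by simp; omega)).symm

lemma suppIn_of_plus_eq_self {a : LFun} (h : plus a = a) : SuppIn (Set.Iic 0) a := by
  intro α e he
  rw [← h, coeff_plus, if_neg]
  simp at he; omega

lemma plus_eq_zero {a : LFun} (h : SuppIn (Set.Ici 1) a) : plus a = 0 := by
  ext1 α; ext e; rw [coeff_plus]
  split_ifs with he
  · rw [h α e (by simp; omega)]; simp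
  · simp

lemma suppIn_of_plus_eq_zero {a : LFun} (h : plus a = 0) : SuppIn (Set.Ici 1) a := by
  intro α e he
  have := coeff_plus a α e
  rw [h, if_pos (by simp at he; omega)] at this
  simpa using this.symm

lemma SuppIn.flip {s : Set ℤ} {a : LFun} (h : SuppIn s a) : SuppIn s (flip a) := fun α e he => by
  change ((e.negOnePow : ℤ) : ℂ) * (coeff α a).coeff e = 0
  rw [h α e he, mul_zero]

lemma coeff_coeffLam (i : ℤ) (a : LFun) (α : ℕ →₀ ℕ) :
    coeff α (coeffLam i a) = (coeff α a).coeff (-i) := rfl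

lemma coeffLam_add (i : ℤ) (a b : LFun) : coeffLam i (a + b) = coeffLam i a + coeffLam i b := by
  ext1 α; simp [coeff_coeffLam]

lemma coeffLam_neg (i : ℤ) (a : LFun) : coeffLam i (-a) = -coeffLam i a := by
  ext1 α; simp [coeff_coeffLam]

lemma coeffLam_zero (i : ℤ) : coeffLam i 0 = 0 := by
  ext1 α; simp [coeff_coeffLam]

lemma coeffLam_eq_zero {s : Set ℤ} {a : LFun} (h : SuppIn s a) {i : ℤ} (hi : -i ∉ s) :
    coeffLam i a = 0 := by
  ext1 α; exact h α _ hi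

lemma dt_coeffLam (k : ℕ) (i : ℤ) (a : LFun) : dt k (coeffLam i a) = coeffLam i (dtL k a) := by
  ext1 α
  rw [coeff_coeffLam, coeff_dtL, dt, coeff_pderiv, coeff_coeffLam]

end Calculus

/-! ### Matrices of formal loops -/

section MatrixCalculus

variable {m n : ℕ}

/-- The exponents of `λ⁻¹` in the entries of `A` lie in `s`. -/
def MSupp (s : Set ℤ) (A : Mat m n LFun) : Prop := ∀ a b, SuppIn s (A a b)

namespace MSupp

variable {s s' t : Set ℤ} {A A' : Mat m n LFun}

lemma mono (h : MSupp s A) (hs : s ⊆ t) : MSupp t A := fun a b => (h a b).mono hs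

lemma add (h : MSupp s A) (h' : MSupp s A') : MSupp s (A + A') := fun a b => (h a b).add (h' a b)

lemma mul (h : MSupp s A) (h' : MSupp s' A') (hs : ∀ i ∈ s, ∀ j ∈ s', i + j ∈ t) :
    MSupp t (A * A') := fun a b => by
  rw [Matrix.mul_apply]
  exact SuppIn.sum fun c _ => (h a c).mul (h' c b) hs

lemma one (h0 : 0 ∈ s) : MSupp s (1 : Mat m n LFun) := fun a b => by
  rw [Matrix.one_apply]
  split_ifs
  · exact SuppIn.one h0
  · exact SuppIn.zero

lemma trace (h : MSupp s A) : SuppIn s A.trace := SuppIn.sum fun a _ => h a a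

lemma twistC : MSupp {0} (twistC m n) := by
  have h1 : SuppIn {0} (1 : LFun) := SuppIn.one rfl
  have h2 : ∀ k, SuppIn {0} ((-1 : LFun) ^ k) := by
    intro k
    rcases neg_one_pow_eq_or LFun k with h | h <;> rw [h]
    · exact h1
    · exact h1.neg
  have h3 : ∀ {p : Prop} [Decidable p] {x : LFun}, SuppIn {0} x →
      SuppIn {0} (if p then x else 0) := by
    intro p _ x hx
    split_ifs
    · exact hx
    · exact SuppIn.zero
  intro a b
  rcases a with a | a <;> rcases b with b | b
  · simp only [CCKP.twistC, fromBlocks_apply₁₁, Matrix.sum_apply, Matrix.add_apply,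
      Matrix.single_apply]
    exact SuppIn.sum fun i _ => (h3 h1).add (h3 h1)
  · exact SuppIn.zero
  · exact SuppIn.zero
  · simp only [CCKP.twistC, fromBlocks_apply₂₂, Matrix.sum_apply, Matrix.single_apply]
    exact SuppIn.sum fun i _ => h3 (h2 _)

end MSupp

lemma map_mul_of_leibniz {R : Type} [CommRing R] {d : R → R} (ha : ∀ a b, d (a + b) = d a + d b)
    (hm : ∀ a b, d (a * b) = d a * b + a * d b) (A A' : Mat m n R) :
    (A * A').map d = A.map d * A' + A * A'.map d := by
  ext1 i j
  have hs : ∀ (S : Finset (Idx m n)) (F : Idx m n → R), d (∑ i ∈ S, F i) = ∑ i ∈ S, d (F i) :=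
    fun S F => map_sum (AddMonoidHom.mk' d ha) F S
  rw [Matrix.map_apply, Matrix.mul_apply, hs, Matrix.add_apply, Matrix.mul_apply, Matrix.mul_apply,
    ← Finset.sum_add_distrib]
  exact Finset.sum_congr rfl fun _ _ => hm _ _

lemma map_dtL_mul (k : ℕ) (A A' : Mat m n LFun) :
    (A * A').map (dtL k) = A.map (dtL k) * A' + A * A'.map (dtL k) :=
  map_mul_of_leibniz (dtL_add k) (dtL_mul k) A A'

lemma map_dLam_mul (A A' : Mat m n LFun) :
    (A * A').map dLam = A.map dLam * A' + A * A'.map dLam :=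
  map_mul_of_leibniz dLam_add dLam_mul A A'

lemma map_additive_add {R S : Type} [AddCommGroup R] [AddCommGroup S] {d : R → S}
    (ha : ∀ a b, d (a + b) = d a + d b) (A A' : Mat m n R) :
    (A + A').map d = A.map d + A'.map d := by
  ext1 i j; exact ha _ _

lemma map_additive_sub {R S : Type} [AddCommGroup R] [AddCommGroup S] {d : R → S}
    (ha : ∀ a b, d (a + b) = d a + d b) (A A' : Mat m n R) :
    (A - A').map d = A.map d - A'.map d := by
  ext1 i j; exact map_sub (AddMonoidHom.mk' d ha) _ _

lemma map_one_of_leibniz {R : Type} [CommRing R] {d : R → R} (ha : ∀ a b, d (a + b) = d a + d b)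
    (hm : ∀ a b, d (a * b) = d a * b + a * d b) : (1 : Mat m n R).map d = 0 := by
  have h := map_mul_of_leibniz ha hm (1 : Mat m n R) 1
  rw [mul_one, mul_one, one_mul] at h
  exact left_eq_add.1 h

lemma map_inv_of_leibniz {R : Type} [CommRing R] {d : R → R} (ha : ∀ a b, d (a + b) = d a + d b)
    (hm : ∀ a b, d (a * b) = d a * b + a * d b) {A A' : Mat m n R} (h : A * A' = 1) :
    A'.map d = -(A' * A.map d * A') := by
  have h' : A' * A = 1 := mul_eq_one_comm.1 h
  have h1 := map_mul_of_leibniz ha hm A A'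
  rw [h, map_one_of_leibniz ha hm] at h1
  have h2 : A' * (A.map d * A' + A * A'.map d) = 0 := by rw [← h1, mul_zero]
  rw [mul_add, ← mul_assoc A' A, h', one_mul, ← mul_assoc] at h2
  exact eq_neg_of_add_eq_zero_right h2

lemma trace_map {R S : Type} [AddCommGroup R] [AddCommGroup S] {d : R → S}
    (ha : ∀ a b, d (a + b) = d a + d b) (A : Mat m n R) : d A.trace = (A.map d).trace :=
  map_sum (AddMonoidHom.mk' d ha) _ _

end MatrixCalculus

end

end CCKP

namespace CCKP

noncomputable section

/-! ### The second derivatives of the tau function -/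

section Algebra

variable {A : Type*} [Ring A]

lemma dressing_mul {M N Mt P W F : A} (h : N * M = 1) :
    (Mt * N - M * P * N) * (M * (W * F)) = Mt * (W * F) + M * (-(P * W) * F) := by
  have : (Mt * N - M * P * N) * (M * (W * F)) =
    Mt * (N * M) * (W * F) - M * P * (N * M) * (W * F) := by noncomm_ring
  rw [this, h]; noncomm_ring

lemma logDeriv_mul {M N Ml Mt P : A} (h : N * M = 1) (h' : M * N = 1) :
    M * -(N * Ml * N) * (Mt * N - M * P * N) = -(Ml * N * (Mt * N)) + Ml * P * N := by
  have : M * -(N * Ml * N) * (Mt * N - M * P * N) =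
    -((M * N) * Ml * N * (Mt * N)) + (M * N) * Ml * (N * M) * P * N := by noncomm_ring
  rw [this, h, h']; noncomm_ring

lemma gauge_mul (D Dx M P Q : A) :
    Dx * M + D * (M * P - Q * M) = D * M * P - (D * Q - Dx) * M := by
  noncomm_ring

/-- Here `Ml`, `Mx`, `Mlx`, `Jl` stand for M_λ, M_x, M_{λx}, J_λ. Cyclicity of the trace identifies
the x-derivative of tr(M_λ J^p M⁻¹), up to sign and tr(J_λ J^p), with the trace of the λ-derivative
of M J M⁻¹ - M_x M⁻¹ against M J^p M⁻¹. -/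
lemma trace_dressing {I R : Type*} [Fintype I] [DecidableEq I] [CommRing R]
    {M N Ml Mx Mlx j Jl : Matrix I I R} (h : N * M = 1) (p : ℕ) :
    (((Ml * j + M * Jl) * N + M * j * -(N * Ml * N) -
      (Mlx * N + Mx * -(N * Ml * N))) * (M * j ^ p * N)).trace =
      -(((Mlx * j ^ p + Ml * 0) * N + Ml * j ^ p * -(N * Mx * N)).trace) +
        (Jl * j ^ p).trace := by
  have e : ((Ml * j + M * Jl) * N + M * j * -(N * Ml * N) -
      (Mlx * N + Mx * -(N * Ml * N))) * (M * j ^ p * N) =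
      Ml * (j * j ^ p * N) + M * (Jl * j ^ p * N) - M * j * N * (Ml * (j ^ p * N))
        - Mlx * (j ^ p * N) + Mx * N * (Ml * (j ^ p * N)) := by
    calc _ = Ml * j * (N * M) * (j ^ p * N) + M * Jl * (N * M) * (j ^ p * N)
          - M * j * N * Ml * (N * M) * (j ^ p * N) - Mlx * (N * M) * (j ^ p * N)
          + Mx * N * Ml * (N * M) * (j ^ p * N) := by noncomm_ring
      _ = _ := by rw [h]; noncomm_ring
  have t1 : (M * j * N * (Ml * (j ^ p * N))).trace = (Ml * (j * j ^ p * N)).trace := by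
    rw [Matrix.trace_mul_comm]
    have : Ml * (j ^ p * N) * (M * j * N) = Ml * (j ^ p * (N * M) * j * N) := by noncomm_ring
    rw [this, h, mul_one, ← pow_succ, pow_succ']
  have t2 : (M * (Jl * j ^ p * N)).trace = (Jl * j ^ p).trace := by
    rw [Matrix.trace_mul_comm, mul_assoc (Jl * j ^ p), h, mul_one]
  have t3 : (Mx * N * (Ml * (j ^ p * N))).trace = (Ml * j ^ p * (N * Mx * N)).trace := by
    rw [Matrix.trace_mul_comm]; congr 1; noncomm_ring
  rw [e, Matrix.trace_add, Matrix.trace_sub, Matrix.trace_sub, Matrix.trace_add, t1, t2, t3,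
    Matrix.trace_add, mul_zero, add_zero, mul_neg, Matrix.trace_neg, mul_assoc Mlx]
  ring

end Algebra

/-! ### Dressing equations and the residue formula -/

section Tau

open MvPowerSeries

variable {m n : ℕ}

lemma Twisted.mul_inv {g : Mat m n LFun} (h : Twisted g) : g * g⁻¹ = 1 :=
  Matrix.mul_nonsing_inv g (Matrix.isUnit_det_of_right_inverse h)

/-- The twist condition exhibits the inverse as a transpose with λ ↦ -λ, conjugated by a constant
matrix, and none of these operations moves the support. -/
lemma Twisted.mSupp_inv {g : Mat m n LFun} (h : Twisted g) {s : Set ℤ} (hs : MSupp s g) :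
    MSupp s g⁻¹ := by
  rw [Matrix.inv_eq_right_inv h]
  have hf : MSupp s ((g.map flip)ᵀ) := fun a b => (hs b a).flip
  refine MSupp.mul (MSupp.mul MSupp.twistC hf (t := s) ?_) MSupp.twistC ?_
  · rintro i rfl j hj; simpa using hj
  · rintro i hi j rfl; simpa using hi

lemma InMinus.mSupp_sub_one {g : Mat m n LFun} (h : InMinus g) : MSupp (Set.Ici 1) (g - 1) := by
  intro a b
  refine suppIn_of_plus_eq_zero ?_
  have h1 : plus (g a b) = (1 : Mat m n LFun) a b := by rw [← h.plus_eq]; rfl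
  have h2 : plus ((1 : Mat m n LFun) a b) = (1 : Mat m n LFun) a b :=
    plus_eq_self (MSupp.one (by simp) a b)
  rw [Matrix.sub_apply, sub_eq_add_neg, plus_add, plus_neg, h1, h2, add_neg_cancel]

lemma InMinus.mSupp {g : Mat m n LFun} (h : InMinus g) : MSupp (Set.Ici 0) g := by
  have := (h.mSupp_sub_one.mono (Set.Ici_subset_Ici.2 zero_le_one)).add (MSupp.one (by simp))
  rwa [sub_add_cancel] at this

lemma InMinus.mSupp_dtL {g : Mat m n LFun} (h : InMinus g) (k : ℕ) :
    MSupp (Set.Ici 1) (g.map (dtL k)) := by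
  have h1 : g.map (dtL k) = (g - 1).map (dtL k) := by
    rw [map_additive_sub (dtL_add k), map_one_of_leibniz (dtL_add k) (dtL_mul k), sub_zero]
  rw [h1]
  exact fun a b => (h.mSupp_sub_one a b).dtL k

lemma InMinus.mSupp_dLam {g : Mat m n LFun} (h : InMinus g) :
    MSupp (Set.Ici 2) (g.map dLam) := by
  intro a b
  refine (h.mSupp a b).dLam.mono ?_
  rintro e ⟨h1, h2⟩
  simp at h1 ⊢
  omega

lemma JL_pow (k : ℕ) : JL m n ^ k = (J m n ^ k).map ofLoop :=
  (map_pow ofLoop.mapMatrix (J m n) k).symm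

lemma map_dtL_vacuum (k : ℕ) :
    (vacuum m n).map (dtL k) = -(JL m n ^ (2 * k + 1) * vacuum m n) := by
  ext1 i j
  ext1 α
  have hcoeff : ∀ (a b : Idx m n) (β : ℕ →₀ ℕ), coeff β (vacuum m n a b) =
      ((-1 : ℂ) ^ β.degree / (β.prod fun _ a => (a.factorial : ℂ))) •
      (J m n ^ (β.sum fun k a => (2 * k + 1) * a)) a b := fun _ _ _ => rfl
  have hR : coeff α ((-(JL m n ^ (2 * k + 1) * vacuum m n)) i j) =
      -(((-1 : ℂ) ^ α.degree / (α.prod fun _ a => (a.factorial : ℂ))) •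
        (J m n ^ ((2 * k + 1) + α.sum fun k a => (2 * k + 1) * a)) i j) := by
    rw [Matrix.neg_apply, map_neg, Matrix.mul_apply, map_sum, pow_add (J m n), Matrix.mul_apply,
      Finset.smul_sum]
    congr 1
    refine Finset.sum_congr rfl fun c _ => ?_
    rw [JL_pow, Matrix.map_apply, ofLoop, coeff_C_mul, hcoeff, ← HahnSeries.C_mul_eq_smul,
      ← HahnSeries.C_mul_eq_smul, mul_left_comm]
  rw [hR, Matrix.map_apply, dtL, coeff_pderiv, hcoeff]
  have hdeg : (α + Finsupp.single k 1).degree = α.degree + 1 := by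
    rw [map_add, Finsupp.degree_single]
  have hsum : ((α + Finsupp.single k 1).sum fun k a => (2 * k + 1) * a) =
      (2 * k + 1) + α.sum fun k a => (2 * k + 1) * a := by
    rw [Finsupp.sum_add_index' (by simp) (by intros; ring), Finsupp.sum_single_index (by simp)]
    ring
  have hprod : ((α + Finsupp.single k 1).prod fun _ a => (a.factorial : ℂ)) =
      (α.prod fun _ a => (a.factorial : ℂ)) * (α k + 1) := by
    classical
    have h1 : ∀ β : ℕ →₀ ℕ, β.support ⊆ insert k α.support →
        (β.prod fun _ a => (a.factorial : ℂ)) =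
        ∏ x ∈ insert k α.support, ((β x).factorial : ℂ) := fun β hβ =>
      Finsupp.prod_of_support_subset _ hβ _ (by simp)
    rw [h1 α (Finset.subset_insert _ _), h1 _ (by
      intro x hx
      rw [Finset.mem_insert, Finsupp.mem_support_iff]
      rw [Finsupp.mem_support_iff, Finsupp.add_apply, Finsupp.single_apply] at hx
      by_cases hk : k = x
      · exact Or.inl hk.symm
      · rw [if_neg hk] at hx; exact Or.inr (by simpa using hx)),
      ← Finset.mul_prod_erase _ _ (Finset.mem_insert_self k _),
      ← Finset.mul_prod_erase _ _ (Finset.mem_insert_self k _)]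
    have h2 : ∏ x ∈ (insert k α.support).erase k, (((α + Finsupp.single k 1 : ℕ →₀ ℕ) x).factorial : ℂ) =
        ∏ x ∈ (insert k α.support).erase k, ((α x).factorial : ℂ) := by
      refine Finset.prod_congr rfl fun x hx => ?_
      rw [Finsupp.add_apply, Finsupp.single_apply, if_neg (Finset.ne_of_mem_erase hx).symm,
        add_zero]
    rw [h2, Finsupp.add_apply, Finsupp.single_eq_same, Nat.factorial_succ]
    push_cast
    ring
  rw [hdeg, hsum, hprod]
  have hc : ((α k : LaurentSeries ℂ) + 1) = HahnSeries.C ((α k : ℂ) + 1) := by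
    rw [map_add, map_natCast, map_one]
  rw [hc, mul_comm, HahnSeries.C_mul_eq_smul, smul_smul]
  refine Eq.trans ?_ (neg_smul _ _)
  congr 1
  have h0 : ((α k : ℂ) + 1) ≠ 0 := Nat.cast_add_one_ne_zero _
  have h1 : (α.prod fun _ a => (a.factorial : ℂ)) ≠ 0 :=
    Finset.prod_ne_zero_iff.2 fun x _ => Nat.cast_ne_zero.2 (Nat.factorial_ne_zero (α x))
  field_simp
  ring

variable {f : Mat m n (LaurentSeries ℂ)} {M E : Mat m n LFun} {τ : Fun}

/-- `M_t M⁻¹ = A - A₊` for `A = M J^(2k+1) M⁻¹`. -/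
lemma IsTau.map_dtL (h : IsTau f M E τ) (k : ℕ) :
    M.map (dtL k) * M⁻¹ = M * JL m n ^ (2 * k + 1) * M⁻¹ -
        (M * JL m n ^ (2 * k + 1) * M⁻¹).map plus ∧
      E.map (dtL k) * E⁻¹ = M.map (dtL k) * M⁻¹ - M * JL m n ^ (2 * k + 1) * M⁻¹ ∧
      ((f.map ofLoop)⁻¹ : Mat m n LFun).map (dtL k) = 0 := by
  have hM := h.M_mem.twisted.mul_inv
  have hM' : M⁻¹ * M = 1 := mul_eq_one_comm.1 hM
  have hE := h.E_mem.twisted.mul_inv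
  have hF : ((f.map ofLoop)⁻¹ : Mat m n LFun).map (dtL k) = 0 := by
    rw [map_inv_of_leibniz (dtL_add k) (dtL_mul k) h.f_mem.twisted.mul_inv]
    have : (f.map ofLoop).map (dtL k) = 0 := by ext1 i j; exact dtL_ofLoop _ _
    rw [this, mul_zero, zero_mul, neg_zero]
  set F : Mat m n LFun := (f.map ofLoop)⁻¹ with hFdef
  have hfac : E = M * (vacuum m n * F) := by
    rw [h.factor, ← mul_assoc, hM, one_mul]
  set A := M * JL m n ^ (2 * k + 1) * M⁻¹ with hA
  have hEt : E.map (dtL k) * E⁻¹ = M.map (dtL k) * M⁻¹ - A := by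
    have h1 : E.map (dtL k) = (M.map (dtL k) * M⁻¹ - A) * E := by
      rw [hfac, map_dtL_mul, map_dtL_mul, hF, mul_zero, add_zero, map_dtL_vacuum]
      exact (dressing_mul hM').symm
    rw [h1, mul_assoc, hE, mul_one]
  refine ⟨?_, hEt, hF⟩
  -- E_t E⁻¹ = M_t M⁻¹ - A has no negative powers of λ and M_t M⁻¹ has only negative ones. Taking
  -- nonnegative parts therefore isolates A₊.
  have hEs : MSupp (Set.Iic 0) E := fun a b =>
    suppIn_of_plus_eq_self (congrFun (congrFun h.E_mem.plus_eq a) b)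
  have hEE : MSupp (Set.Iic 0) (E.map (dtL k) * E⁻¹) := by
    refine MSupp.mul (fun a b => (hEs a b).dtL k) (h.E_mem.twisted.mSupp_inv hEs) ?_
    intro i hi j hj
    simp at hi hj ⊢; omega
  have hMM : MSupp (Set.Ici 1) (M.map (dtL k) * M⁻¹) := by
    refine MSupp.mul (h.M_mem.mSupp_dtL k) (h.M_mem.twisted.mSupp_inv h.M_mem.mSupp) ?_
    intro i hi j hj
    simp at hi hj ⊢; omega
  rw [hEt] at hEE
  have h1 : (M.map (dtL k) * M⁻¹ - A).map plus = M.map (dtL k) * M⁻¹ - A := by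
    ext1 a b; exact plus_eq_self (hEE a b)
  have h2 : (M.map (dtL k) * M⁻¹).map plus = 0 := by
    ext1 a b; exact plus_eq_zero (hMM a b)
  rw [map_additive_sub plus_add, h2, zero_sub] at h1
  rw [sub_eq_add_neg, h1]; abel

lemma dLam_J : (JL m n).map dLam = single (Sum.inr 0) (Sum.inr (Fin.last _)) 1 := by
  have h0 : dLam₀ lam = 1 := by
    ext e
    rw [coeff_dLam₀, lam, HahnSeries.coeff_single, HahnSeries.coeff_one]
    by_cases he : e = 0
    · simp [he]
    · rw [if_neg (by omega), if_neg he]; simp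
  have hc : ∀ a b, dLam₀ (bMat m n (LaurentSeries ℂ) a b) = 0 := by
    have hz : dLam₀ 0 = 0 := by ext e; simp [coeff_dLam₀]
    have h1 : dLam₀ 1 = 0 := by
      ext e
      rw [coeff_dLam₀, HahnSeries.coeff_one]
      split_ifs with he
      · simp [he]
      · simp
    intro a b
    rcases a with a | a <;> rcases b with b | b
    iterate 3 exact hz
    simp only [bMat, fromBlocks_apply₂₂, Matrix.sum_apply, Matrix.single_apply]
    rw [show dLam₀ (∑ i : Fin (2 * n), if i.succ = a ∧ i.castSucc = b then 1 else 0) =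
      ∑ i : Fin (2 * n), dLam₀ (if i.succ = a ∧ i.castSucc = b then 1 else 0) from
        map_sum (AddMonoidHom.mk' dLam₀ dLam₀_add) _ _]
    refine Finset.sum_eq_zero fun i _ => ?_
    split_ifs
    · exact h1
    · exact hz
  ext1 a b
  rw [Matrix.map_apply, JL, Matrix.map_apply, dLam_ofLoop, J, Matrix.add_apply, dLam₀_add, hc,
    add_zero, Matrix.single_apply, Matrix.single_apply]
  split_ifs
  · rw [h0, map_one]
  · have hz : dLam₀ 0 = 0 := by ext e; simp [coeff_dLam₀]
    rw [hz, map_zero]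

lemma mSupp_JL : MSupp (Set.Iic 0) (JL m n) := by
  intro a b α e he
  classical
  rw [JL, Matrix.map_apply, ofLoop, coeff_C]
  split_ifs
  · have he' : 0 < e := by simpa using he
    have hl : lam.coeff e = 0 := by
      rw [lam, HahnSeries.coeff_single, if_neg]; omega
    have h1 : (1 : LaurentSeries ℂ).coeff e = 0 := by
      rw [HahnSeries.coeff_one, if_neg]; omega
    rw [J, Matrix.add_apply, HahnSeries.coeff_add, Matrix.single_apply]
    have hb : (bMat m n (LaurentSeries ℂ) a b).coeff e = 0 := by
      rcases a with a | a <;> rcases b with b | b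
      iterate 3 rfl
      simp only [bMat, fromBlocks_apply₂₂, Matrix.sum_apply, Matrix.single_apply,
        HahnSeries.coeff_sum]
      refine Finset.sum_eq_zero fun i _ => ?_
      split_ifs
      · exact h1
      · rfl
    rw [hb, add_zero]
    split_ifs
    · exact hl
    · rfl
  · rfl

lemma mSupp_JL_pow (k : ℕ) : MSupp (Set.Iic 0) (JL m n ^ k) := by
  induction k with
  | zero => rw [pow_zero]; exact MSupp.one (by simp)
  | succ k ih =>
    rw [pow_succ]
    refine ih.mul mSupp_JL ?_
    intro i hi j hj
    simp at hi hj ⊢; omega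

/-- `∂ ln τ = - Res tr (M_λ J^(2k+1) M⁻¹)`. -/
lemma IsTau.dt_log (h : IsTau f M E τ) (k : ℕ) :
    dt k τ * τ⁻¹ = -coeffLam (-1) (M.map dLam * JL m n ^ (2 * k + 1) * M⁻¹).trace := by
  obtain ⟨-, hE, hF⟩ := h.map_dtL k
  have hM := h.M_mem.twisted.mul_inv
  have hM' : M⁻¹ * M = 1 := mul_eq_one_comm.1 hM
  have hc := congrFun (congrArg ExtLoop.conn h.lift_eq) k
  have hdl : (1 : Mat m n LFun).map dLam = 0 := map_one_of_leibniz dLam_add dLam_mul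
  simp only [ExtLoop.mul, ExtLoop.lift, ExtLoop.scalar, ExtLoop.logDeriv, ExtAlg.Ad, hF, one_mul,
    hE, hdl, pairing, mul_zero, zero_mul, Matrix.trace_zero, coeffLam_zero, Pi.zero_apply,
    add_zero, zero_add] at hc
  rw [Matrix.inv_eq_right_inv hM', map_inv_of_leibniz dLam_add dLam_mul hM] at hc
  have e1 : M * -(M⁻¹ * M.map dLam * M⁻¹) *
      (M.map (dtL k) * M⁻¹ - M * JL m n ^ (2 * k + 1) * M⁻¹) =
      -(M.map dLam * M⁻¹ * (M.map (dtL k) * M⁻¹)) + M.map dLam * JL m n ^ (2 * k + 1) * M⁻¹ :=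
    logDeriv_mul hM' hM
  rw [e1, Matrix.trace_add, Matrix.trace_neg, coeffLam_add, coeffLam_neg] at hc
  -- M_λ is O(λ⁻²) and M_t is O(λ⁻¹), so the product is O(λ⁻³) and has no residue.
  have hz : coeffLam (-1) (M.map dLam * M⁻¹ * (M.map (dtL k) * M⁻¹)).trace = 0 := by
    have hi := h.M_mem.twisted.mSupp_inv h.M_mem.mSupp
    refine coeffLam_eq_zero (s := Set.Ici 3) (MSupp.trace (MSupp.mul (s := Set.Ici 2)
      (s' := Set.Ici 1) (MSupp.mul h.M_mem.mSupp_dLam hi ?_)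
      (MSupp.mul (h.M_mem.mSupp_dtL k) hi ?_) ?_)) (by simp)
    all_goals
      intro i hi j hj
      simp at hi hj ⊢; omega
  rw [hz, neg_zero, zero_add] at hc
  exact eq_neg_of_add_eq_zero_left hc.symm

/-- `(ln τ)_{t₁ t_{2k+1}} = Res tr (((M J M⁻¹)₊)_λ M J^(2k+1) M⁻¹)`. -/
lemma IsTau.logTau₂_eq (h : IsTau f M E τ) (k : ℕ) :
    logTau₂ τ 0 k = coeffLam (-1) (((M * JL m n * M⁻¹).map plus).map dLam *
      (M * JL m n ^ (2 * k + 1) * M⁻¹)).trace := by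
  have hM := h.M_mem.twisted.mul_inv
  have hM' : M⁻¹ * M = 1 := mul_eq_one_comm.1 hM
  have hplus : (M * JL m n * M⁻¹).map plus = M * JL m n * M⁻¹ - M.map (dtL 0) * M⁻¹ := by
    have := (h.map_dtL 0).1
    rw [mul_zero, zero_add, pow_one] at this
    rw [this]; abel
  have hJt : ∀ p, (JL m n ^ p).map (dtL 0) = 0 := by
    intro p; rw [JL_pow]; ext1 i j; exact dtL_ofLoop _ _
  have hmixed : (M.map (dtL 0)).map dLam = (M.map dLam).map (dtL 0) := by
    ext1 i j; exact dLam_dtL _ _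
  rw [logTau₂, h.dt_log, hplus]
  set p := 2 * k + 1
  have hneg : ∀ a : Fun, dt 0 (-a) = -dt 0 a := fun a => map_neg _ a
  rw [hneg, dt_coeffLam, trace_map (dtL_add 0), map_additive_sub dLam_add, map_dLam_mul,
    map_dLam_mul, map_dLam_mul, map_dtL_mul, map_dtL_mul, hJt,
    map_inv_of_leibniz (dtL_add 0) (dtL_mul 0) hM, map_inv_of_leibniz dLam_add dLam_mul hM, hmixed]
  -- The extra term is polynomial in λ.
  have hJJ : coeffLam (-1) ((JL m n).map dLam * JL m n ^ p).trace = 0 := by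
    refine coeffLam_eq_zero (s := Set.Iic 0) (MSupp.trace (MSupp.mul (s := Set.Iic 0)
      (s' := Set.Iic 0) ?_ (mSupp_JL_pow p) ?_)) (by simp)
    · rw [dLam_J]
      intro a b
      rw [Matrix.single_apply]
      split_ifs
      · exact SuppIn.one (by simp)
      · exact SuppIn.zero
    · intro i hi j hj
      simp at hi hj ⊢; omega
  rw [trace_dressing hM', coeffLam_add, coeffLam_neg, hJJ, add_zero]

lemma IsGauge.det_eq {Δ : Mat m n Fun} (h : IsGauge Δ) : Δ.det = 1 := by
  obtain ⟨D, rfl, h1, h2⟩ := h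
  rw [Matrix.det_fromBlocks_zero₂₁, Matrix.det_one, one_mul, Matrix.det_of_isUpperTriangular]
  · simp [h1]
  · intro a b hab; exact h2 a b hab

/-- The dressing matrix `ΔM`, its inverse, its `x`-derivative and the tau function. -/
theorem IsTau.exists_dressing (h : IsTau f M E τ) {v : Fields m n} (hv : IsAttached M v) :
    ∃ (Δ : Mat m n Fun) (g : Mat m n LFun), IsGauge Δ ∧ (Δ.map ofFun * M) * g = 1 ∧
      (Δ.map ofFun * M).map (dtL 0) = Δ.map ofFun * M * JL m n -
        (JL m n + v.toMat.map ofFun) * (Δ.map ofFun * M) ∧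
      ∀ k, logTau₂ τ 0 k = coeffLam (-1)
        ((Δ.map ofFun * M * JL m n ^ (2 * k + 1) * g) (.inr (Fin.last _)) (.inr 0)) := by
  obtain ⟨Δ, hΔ, hatt⟩ := hv
  have hM := h.M_mem.twisted.mul_inv
  have hM' : M⁻¹ * M = 1 := mul_eq_one_comm.1 hM
  have hdet : (Δ.map ofFun).det = 1 := by
    have := RingHom.map_det ofFun Δ
    rw [hΔ.det_eq, map_one] at this
    exact this.symm
  set D : Mat m n LFun := Δ.map ofFun with hD
  have hDD : D * D⁻¹ = 1 := Matrix.mul_nonsing_inv _ (by rw [hdet]; exact isUnit_one)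
  have hDD' : D⁻¹ * D = 1 := mul_eq_one_comm.1 hDD
  refine ⟨Δ, M⁻¹ * D⁻¹, hΔ, ?_, ?_, ?_⟩
  · rw [mul_assoc, ← mul_assoc M, hM, one_mul, hDD]
  · have hplus := (h.map_dtL 0).1
    rw [mul_zero, zero_add, pow_one] at hplus
    have hMx : M.map (dtL 0) = M * JL m n - (M * JL m n * M⁻¹).map plus * M := by
      have := congrArg (· * M) hplus
      simp only [sub_mul, mul_assoc, hM', mul_one] at this
      simpa only [mul_assoc] using this
    rw [map_dtL_mul, hMx, ← mul_assoc (JL m n + _), ← hatt]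
    exact gauge_mul _ _ _ _ _
  · intro k
    rw [h.logTau₂_eq]
    -- Differentiating the gauge relation in λ leaves only the derivative of J, the single unit
    -- e_{1,N}, which turns the trace into one matrix entry.
    have hdD : D.map dLam = 0 := by ext1 i j; exact dLam_ofFun _
    have hdDx : (D.map (dtL 0)).map dLam = 0 := by
      have : (D.map (dtL 0)).map dLam = (D.map dLam).map (dtL 0) := by
        ext1 i j; exact dLam_dtL _ _
      rw [this, hdD]; ext1 i j; exact map_zero (pderiv _ 0)
    have hdV : (v.toMat.map ofFun).map dLam = 0 := by ext1 i j; exact dLam_ofFun _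
    have hQ := congrArg (fun A => Matrix.map A dLam) hatt
    simp only [map_additive_sub dLam_add, map_dLam_mul, hdD, hdDx, sub_zero, zero_mul, zero_add,
      mul_zero, add_zero, map_additive_add dLam_add, hdV, dLam_J] at hQ
    have hQ' : ((M * JL m n * M⁻¹).map plus).map dLam =
        D⁻¹ * (single (Sum.inr 0) (Sum.inr (Fin.last _)) 1 * D) := by
      rw [← hQ, ← mul_assoc, hDD', one_mul]
    rw [hQ', mul_assoc, Matrix.trace_mul_comm, mul_assoc, mul_assoc, Matrix.trace_single_mul]
    simp only [one_smul, mul_assoc]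
    rfl

end Tau

end

end CCKP

namespace CCKP

noncomputable section

/-! ### Power series in `λ⁻¹` and the passage to `λ = z^(2n+1)` -/

section Bridge

open MvPowerSeries

/-- The coefficients of `t^α` in a power series over the formal functions. -/
def coeffSeries (α : ℕ →₀ ℕ) (a : PowerSeries Fun) : PowerSeries ℂ :=
  PowerSeries.mk fun i => coeff α (PowerSeries.coeff i a)

/-- The function underlying `ofSeries`. -/
def ofSeriesFun (a : PowerSeries Fun) : LFun :=
  fun α => HahnSeries.ofPowerSeries ℤ ℂ (coeffSeries α a)

lemma coeff_ofSeriesFun (a : PowerSeries Fun) (α : ℕ →₀ ℕ) :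
    coeff α (ofSeriesFun a) = HahnSeries.ofPowerSeries ℤ ℂ (coeffSeries α a) := rfl

/-- A power series with coefficients in the formal functions as a formal loop function, where the
variable is `λ⁻¹`. -/
def ofSeries : PowerSeries Fun →+* LFun where
  toFun := ofSeriesFun
  map_one' := by
    classical
    ext1 α
    have : coeffSeries α 1 = if α = 0 then 1 else 0 := by
      ext i
      rw [coeffSeries, PowerSeries.coeff_mk, PowerSeries.coeff_one]
      by_cases hi : i = 0 <;> by_cases hα : α = 0 <;> simp [hi, hα, coeff_one, PowerSeries.coeff_one]
    rw [coeff_ofSeriesFun, this, coeff_one]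
    split_ifs <;> simp
  map_zero' := by
    ext1 α
    have : coeffSeries α 0 = 0 := by ext i; simp [coeffSeries]
    rw [coeff_ofSeriesFun, this]
    simp
  map_add' a b := by
    ext1 α
    have : coeffSeries α (a + b) = coeffSeries α a + coeffSeries α b := by
      ext i; simp [coeffSeries]
    rw [map_add, coeff_ofSeriesFun, coeff_ofSeriesFun, coeff_ofSeriesFun, this, map_add]
  map_mul' a b := by
    classical
    ext1 α
    have : coeffSeries α (a * b) =
        ∑ p ∈ Finset.HasAntidiagonal.antidiagonal α, coeffSeries p.1 a * coeffSeries p.2 b := by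
      ext i
      simp only [coeffSeries, PowerSeries.coeff_mk, PowerSeries.coeff_mul, map_sum, coeff_mul]
      exact Finset.sum_comm
    rw [coeff_mul, coeff_ofSeriesFun, this, map_sum]
    exact Finset.sum_congr rfl fun p _ => map_mul _ _ _

lemma coeff_ofSeries (a : PowerSeries Fun) (α : ℕ →₀ ℕ) (i : ℕ) :
    (coeff α (ofSeries a)).coeff (i : ℤ) = coeff α (PowerSeries.coeff i a) := by
  change (HahnSeries.ofPowerSeries ℤ ℂ (coeffSeries α a)).coeff (i : ℤ) = _
  rw [HahnSeries.ofPowerSeries_apply_coeff, coeffSeries, PowerSeries.coeff_mk]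

lemma suppIn_ofSeries (a : PowerSeries Fun) : SuppIn (Set.Ici 0) (ofSeries a) := by
  intro α e he
  change (HahnSeries.ofPowerSeries ℤ ℂ (coeffSeries α a)).coeff e = _
  rw [PowerSeries.coeff_coe, if_pos (by simpa using he)]

lemma ofSeries_ext {a : PowerSeries Fun} {b : LFun} (hb : SuppIn (Set.Ici 0) b)
    (h : ∀ i : ℕ, PowerSeries.coeff i a = coeffLam (-i) b) : ofSeries a = b := by
  ext1 α
  ext e
  by_cases he : 0 ≤ e
  · obtain ⟨i, rfl⟩ := Int.eq_ofNat_of_zero_le he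
    rw [coeff_ofSeries, h, coeff_coeffLam, neg_neg]
  · rw [suppIn_ofSeries a α e (by simpa using he), hb α e (by simpa using he)]

lemma coeffLam_ofSeries (a : PowerSeries Fun) (i : ℕ) :
    coeffLam (-i) (ofSeries a) = PowerSeries.coeff i a := by
  ext1 α
  rw [coeff_coeffLam, neg_neg, coeff_ofSeries]

lemma ofSeries_injective : Function.Injective ofSeries := by
  intro a b h
  ext1 i
  rw [← coeffLam_ofSeries, h, coeffLam_ofSeries]

/-- The series of the coefficients of `λ^(-i)`, `i ≥ 0`. -/
def toSeries (b : LFun) : PowerSeries Fun := PowerSeries.mk fun i => coeffLam (-i) b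

lemma ofSeries_toSeries {b : LFun} (hb : SuppIn (Set.Ici 0) b) : ofSeries (toSeries b) = b :=
  ofSeries_ext hb fun _ => PowerSeries.coeff_mk _ _

lemma ofSeries_C (a : Fun) : ofSeries (PowerSeries.C a) = ofFun a := by
  ext1 α
  ext e
  rw [ofFun, coeff_map, HahnSeries.C_apply, HahnSeries.coeff_single]
  by_cases he : 0 ≤ e
  · obtain ⟨i, rfl⟩ := Int.eq_ofNat_of_zero_le he
    rw [coeff_ofSeries, PowerSeries.coeff_C]
    by_cases hi : i = 0 <;> simp [hi]
  · rw [suppIn_ofSeries _ α e (by simpa using he), if_neg (by rintro rfl; simp at he)]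

/-- The loop `λ^(-e)`. -/
def lamPow (e : ℤ) : LFun := ofLoop (HahnSeries.single e 1)

lemma lamPow_mul (e e' : ℤ) : lamPow e * lamPow e' = lamPow (e + e') := by
  rw [lamPow, lamPow, ← map_mul, HahnSeries.single_mul_single, mul_one]; rfl

lemma lamPow_zero : lamPow 0 = 1 := map_one ofLoop

lemma lamPow_pow (e : ℤ) (k : ℕ) : lamPow e ^ k = lamPow (k * e) := by
  induction k with
  | zero => simp [lamPow_zero]
  | succ k ih => rw [pow_succ, ih, lamPow_mul]; congr 1; push_cast; ring

lemma coeff_lamPow_mul (e : ℤ) (a : LFun) (α : ℕ →₀ ℕ) (i : ℤ) :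
    (coeff α (lamPow e * a)).coeff i = (coeff α a).coeff (i - e) := by
  rw [lamPow, ofLoop, coeff_C_mul, HahnSeries.coeff_single_mul, one_mul]

lemma suppIn_lamPow (e : ℤ) : SuppIn {e} (lamPow e) := by
  intro α i hi
  have := coeff_lamPow_mul e 1 α i
  rw [mul_one] at this
  rw [this]
  refine SuppIn.one (s := {0}) rfl α _ ?_
  intro h
  exact hi (by simpa [sub_eq_zero] using h)

lemma ofSeries_X : ofSeries PowerSeries.X = lamPow 1 := by
  refine ofSeries_ext ((suppIn_lamPow 1).mono (by simp)) fun i => ?_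
  classical
  ext1 α
  rw [coeff_coeffLam, neg_neg, PowerSeries.coeff_X, lamPow, ofLoop, coeff_C]
  by_cases hi : i = 1 <;> by_cases hα : α = 0 <;>
    simp [hi, hα, coeff_one]

lemma dtL_ofSeries (k : ℕ) (a : PowerSeries Fun) :
    dtL k (ofSeries a) = ofSeries (coeffwise (dt k) a) := by
  refine (ofSeries_ext ((suppIn_ofSeries a).dtL k) fun i => ?_).symm
  rw [coeff_coeffwise, ← dt_coeffLam, coeffLam_ofSeries]

/-- The substitution `λ = z^(2n+1)`. -/
def subst (n : ℕ) : LFun →+* LFun :=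
  MvPowerSeries.map (HahnSeries.embDomainRingHom (AddMonoidHom.mulLeft ((2 * n + 1 : ℕ) : ℤ))
    (fun a b h => by
      have h0 : ((2 * n + 1 : ℕ) : ℤ) ≠ 0 := by omega
      exact mul_left_cancel₀ h0 h)
    (fun a b => by
      have h0 : (0 : ℤ) < ((2 * n + 1 : ℕ) : ℤ) := by omega
      exact mul_le_mul_iff_right₀ h0))

variable {m n : ℕ}

lemma coeff_subst (a : LFun) (α : ℕ →₀ ℕ) (e : ℤ) :
    (coeff α (subst n a)).coeff (((2 * n + 1 : ℕ) : ℤ) * e) = (coeff α a).coeff e := by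
  rw [subst, coeff_map]
  exact HahnSeries.embDomain_coeff

lemma coeff_subst_of_not_dvd (a : LFun) (α : ℕ →₀ ℕ) {e : ℤ}
    (he : ¬ ∃ e', ((2 * n + 1 : ℕ) : ℤ) * e' = e) : (coeff α (subst n a)).coeff e = 0 := by
  rw [subst, coeff_map]
  refine HahnSeries.embDomain_of_notMem_range ?_
  rintro ⟨e', h⟩
  exact he ⟨e', h⟩

lemma subst_injective : Function.Injective (subst n) := by
  intro a b h
  ext1 α
  ext e
  rw [← coeff_subst (n := n), h, coeff_subst]

lemma dtL_subst (k : ℕ) (a : LFun) : dtL k (subst n a) = subst n (dtL k a) := by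
  ext1 α
  ext e
  rw [coeff_dtL]
  by_cases he : ∃ e', ((2 * n + 1 : ℕ) : ℤ) * e' = e
  · obtain ⟨e', rfl⟩ := he
    rw [coeff_subst, coeff_subst, coeff_dtL]
  · rw [coeff_subst_of_not_dvd _ _ he, coeff_subst_of_not_dvd _ _ he, zero_mul]

lemma subst_ofFun (a : Fun) : subst n (ofFun a) = ofFun a := by
  ext1 α
  rw [subst, coeff_map, ofFun, coeff_map]
  exact HahnSeries.embDomainRingHom_C

lemma subst_lamPow (e : ℤ) : subst n (lamPow e) = lamPow (((2 * n + 1 : ℕ) : ℤ) * e) := by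
  rw [subst, lamPow, ofLoop, MvPowerSeries.map_C]
  congr 1
  exact HahnSeries.embDomain_single

lemma SuppIn.subst {a : LFun} (h : SuppIn (Set.Ici 1) a) :
    SuppIn (Set.Ici ((2 * n + 1 : ℕ) : ℤ)) (subst n a) := by
  intro α e he
  by_cases hd : ∃ e', ((2 * n + 1 : ℕ) : ℤ) * e' = e
  · obtain ⟨e', rfl⟩ := hd
    rw [coeff_subst, h]
    intro h1
    refine he ?_
    simp only [Set.mem_Ici] at h1 ⊢
    nlinarith
  · exact coeff_subst_of_not_dvd _ _ hd

/-- The substitution `λ = z^(2n+1)` followed by conjugation with `diag(z^pos)`. -/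
def principal : Mat m n LFun →+* Mat m n LFun where
  toFun A := Matrix.of fun a b => lamPow (-pos a) * subst n (A a b) * lamPow (pos b)
  map_one' := by
    ext1 a b
    rw [Matrix.of_apply, Matrix.one_apply]
    split_ifs with h
    · rw [h, map_one, mul_one, lamPow_mul, neg_add_cancel, lamPow_zero]
    · simp
  map_zero' := by ext1 a b; simp
  map_add' A A' := by ext1 a b; simp [mul_add, add_mul]
  map_mul' A A' := by
    ext1 a b
    simp only [Matrix.of_apply, Matrix.mul_apply, map_sum, map_mul, Finset.mul_sum, Finset.sum_mul]
    refine Finset.sum_congr rfl fun c _ => ?_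
    have h : lamPow (pos c) * lamPow (-pos c) = 1 := by
      rw [lamPow_mul, add_neg_cancel, lamPow_zero]
    linear_combination (-(lamPow (-pos a) * subst n (A a c) * subst n (A' c b) *
      lamPow (pos b))) * h

lemma principal_apply (A : Mat m n LFun) (a b : Idx m n) :
    principal A a b = lamPow (-pos a) * subst n (A a b) * lamPow (pos b) := rfl

lemma principal_map_dtL (A : Mat m n LFun) (k : ℕ) :
    principal (A.map (dtL k)) = (principal A).map (dtL k) := by
  ext1 a b
  have h : ∀ e, dtL k (lamPow e) = 0 := fun e => dtL_ofLoop _ _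
  rw [Matrix.map_apply, principal_apply, principal_apply, Matrix.map_apply, dtL_mul, dtL_mul, h, h,
    dtL_subst]
  ring

lemma bMat_apply {R : Type} [CommRing R] (a b : Fin (2 * n + 1)) :
    bMat m n R (.inr a) (.inr b) = if (a : ℕ) = b + 1 then 1 else 0 := by
  simp only [bMat, fromBlocks_apply₂₂, Matrix.sum_apply, Matrix.single_apply]
  split_ifs with h
  · have hb : (b : ℕ) < 2 * n := by omega
    rw [Finset.sum_eq_single ⟨b, hb⟩]
    · rw [if_pos]
      exact ⟨Fin.ext (by simp [h]), Fin.ext rfl⟩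
    · intro i _ hi
      rw [if_neg]
      rintro ⟨-, h2⟩
      exact hi (Fin.ext (by simpa using congrArg Fin.val h2))
    · simp
  · refine Finset.sum_eq_zero fun i _ => if_neg ?_
    rintro ⟨h1, h2⟩
    refine h ?_
    rw [← h1, ← h2]; simp

lemma JL_eq : JL m n = single (Sum.inr 0) (Sum.inr (Fin.last _)) (lamPow (-1)) +
    bMat m n LFun := by
  ext1 a b
  rw [JL, Matrix.map_apply, J, Matrix.add_apply, Matrix.add_apply, map_add, Matrix.single_apply,
    Matrix.single_apply]
  congr 1
  · split_ifs
    · rfl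
    · exact map_zero _
  · rcases a with a | a <;> rcases b with b | b
    iterate 3 exact map_zero _
    rw [bMat_apply, bMat_apply]
    split_ifs <;> simp

lemma cyc_eq {R : Type} [CommRing R] :
    cyc m n R = single (Sum.inr 0) (Sum.inr (Fin.last _)) 1 + bMat m n R := by
  ext1 a b
  rw [Matrix.add_apply, Matrix.single_apply]
  rcases a with a | a <;> rcases b with b | b
  iterate 3 simp [cyc, bMat]
  rw [bMat_apply]
  have ha := a.2
  have hb := b.2
  simp only [cyc, fromBlocks_apply₂₂, shift, Matrix.of_apply, Sum.inr.injEq, Fin.ext_iff,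
    Fin.val_zero, Fin.val_last]
  by_cases h : (b : ℕ) = 2 * n
  · rw [h, Nat.mod_self]
    by_cases h0 : (a : ℕ) = 0
    · simp [h0]
    · rw [if_neg h0, if_neg (by omega), if_neg (by omega), add_zero]
  · rw [Nat.mod_eq_of_lt (by omega), if_neg (c := 0 = (a : ℕ) ∧ _) (by omega), zero_add]

/-- Subdiagonal entries gain one z from the conjugation. The corner entry λ = z^(2n+1) loses 2n
powers, so it too becomes z. -/
lemma principal_JL : principal (JL m n) = lamPow (-1) • cyc m n LFun := by
  ext1 a b
  rw [principal_apply, JL_eq, cyc_eq, Matrix.smul_apply, Matrix.add_apply, Matrix.add_apply,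
    Matrix.single_apply, Matrix.single_apply, map_add, smul_eq_mul, mul_add, mul_add, add_mul]
  congr 1
  · split_ifs with h
    · rw [← h.1, ← h.2, subst_lamPow, lamPow_mul, lamPow_mul, mul_one]
      congr 1
      simp [pos]
    · simp
  · rcases a with a | a <;> rcases b with b | b
    iterate 3 simp [bMat]
    rw [bMat_apply]
    split_ifs with h
    · rw [map_one, mul_one, mul_one, lamPow_mul]
      congr 1
      simp [pos, h]
    · simp

/-- Conjugation and the prefactor z⁻¹ give the exponent `pos b + 1 - pos a` of X, which must be
nonnegative wherever the entry is nonzero; hence the hypothesis. -/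
lemma principal_ofFun {A : Mat m n Fun} (h : PosUpper A) :
    lamPow 1 • principal (A.map ofFun) = ofSeries.mapMatrix (scaled A) := by
  ext1 a b
  rw [Matrix.smul_apply, principal_apply, Matrix.map_apply, subst_ofFun, RingHom.mapMatrix_apply,
    Matrix.map_apply, scaled, Matrix.of_apply, map_mul, map_pow, ofSeries_X, ofSeries_C,
    lamPow_pow, smul_eq_mul]
  by_cases hab : pos b < pos a
  · simp [h a b hab]
  · rw [mul_right_comm _ _ (lamPow (pos b)), ← mul_assoc, lamPow_mul, lamPow_mul]
    congr 2
    push_cast [show pos a ≤ pos b + 1 by omega]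
    ring

end Bridge

end

end CCKP

namespace CCKP

noncomputable section

/-! ### The resolvent in the principal grading -/

section Resolvent

variable {m n : ℕ}

lemma commutator_dressing {A : Type*} [Ring A] {h g j V Q hx : A} (hg : h * g = 1) (gh : g * h = 1)
    (hQ : j * Q = Q * j) (hhx : hx = h * j - V * h) :
    hx * Q * g + h * Q * -(g * hx * g) = h * Q * g * V - V * (h * Q * g) := by
  have : hx * Q * g + h * Q * -(g * hx * g) =
      h * (j * Q) * g - V * (h * Q * g) - h * Q * (g * h) * j * g + h * Q * g * V * (h * g) := by
    rw [hhx]; noncomm_ring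
  rw [this, hg, gh, hQ]; noncomm_ring

/-- `h Q h⁻¹` commutes with `∂_x + V` if `h (∂_x + J) h⁻¹ = ∂_x + V` and `[J, Q] = 0`. -/
lemma map_dtL_dressing {h g V Q : Mat m n LFun} (hg : h * g = 1)
    (hx : h.map (dtL 0) = h * JL m n - V * h) (hQ : JL m n * Q = Q * JL m n)
    (hQx : Q.map (dtL 0) = 0) :
    (h * Q * g).map (dtL 0) = h * Q * g * V - V * (h * Q * g) := by
  rw [map_dtL_mul, map_dtL_mul, hQx, mul_zero, add_zero,
    map_inv_of_leibniz (dtL_add 0) (dtL_mul 0) hg]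
  exact commutator_dressing hg (mul_eq_one_comm.1 hg) hQ hx

lemma smul_commutator {I R : Type*} [Fintype I] [CommRing R] {y : R}
    {T V W Sx : Matrix I I R} (hW : y • V = W) (h : Sx = T * V - V * T) :
    y • Sx + (W * T - T * W) = 0 := by
  rw [h, ← hW, smul_sub, smul_mul_assoc, mul_smul_comm]; abel

lemma smul_commutator_cancel {I R : Type*} [Fintype I] [CommRing R] {y z : R}
    (hyz : y * z = 1) {T V Sx : Matrix I I R} (h : z • Sx = z • T * V - V * (z • T)) :
    Sx = T * V - V * T := by
  have := congrArg (fun A => y • A) h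
  simpa only [smul_sub, smul_mul_assoc, mul_smul_comm, smul_smul, hyz, one_smul] using this

lemma smul_add_of_mul_eq_one {I R : Type*} [CommRing R] {y z : R} (hyz : y * z = 1)
    {A B C D : Matrix I I R} (hA : A = z • C) (hB : y • B = D) : y • (A + B) = C + D := by
  rw [smul_add, hA, hB, smul_smul, hyz, one_smul]

lemma mul_smul_pow_mul {I R : Type*} [Fintype I] [DecidableEq I] [CommRing R] (c : R)
    (x a y : Matrix I I R) (k : ℕ) : x * (c • a) ^ k * y = c ^ k • (x * a ^ k * y) := by
  rw [smul_pow, mul_smul_comm, smul_mul_assoc]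

lemma isUnit_det_of_constantCoeff {I : Type*} [Fintype I] [DecidableEq I] {B : Type*} [CommRing B]
    {η : Matrix I I (PowerSeries B)} {c : Matrix I I B} (hc : IsUnit c.det)
    (h : η.map PowerSeries.constantCoeff = c) : IsUnit η.det := by
  rw [PowerSeries.isUnit_iff_constantCoeff]
  have := RingHom.map_det PowerSeries.constantCoeff η
  rw [this, RingHom.mapMatrix_apply, h]
  exact hc

lemma mapMatrix_ofSeries_injective :
    Function.Injective (ofSeries.mapMatrix (m := Idx m n)) := by
  intro A A' h
  ext1 a b
  exact ofSeries_injective (congrFun (congrFun h a) b)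

lemma mapMatrix_ofSeries_X_smul (A : Mat m n (PowerSeries Fun)) :
    ofSeries.mapMatrix ((PowerSeries.X : PowerSeries Fun) • A) =
      lamPow 1 • ofSeries.mapMatrix A := by
  ext1 a b
  simp [ofSeries_X]

lemma mapMatrix_ofSeries_coeffwise (A : Mat m n (PowerSeries Fun)) :
    ofSeries.mapMatrix (A.map (coeffwise (dt 0))) = (ofSeries.mapMatrix A).map (dtL 0) := by
  ext1 a b
  exact (dtL_ofSeries 0 (A a b)).symm

lemma mapMatrix_ofSeries_commutator (A B : Mat m n (PowerSeries Fun)) :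
    ofSeries.mapMatrix ((PowerSeries.X : PowerSeries Fun) • A.map (coeffwise (dt 0)) +
        (B * A - A * B)) =
      lamPow 1 • (ofSeries.mapMatrix A).map (dtL 0) +
        (ofSeries.mapMatrix B * ofSeries.mapMatrix A -
          ofSeries.mapMatrix A * ofSeries.mapMatrix B) := by
  rw [map_add, mapMatrix_ofSeries_X_smul, mapMatrix_ofSeries_coeffwise, map_sub, map_mul, map_mul]

/-- Entries strictly above the diagonal acquire negative powers of z, so a gauge matrix, constant in
λ, also becomes 1 + O(z⁻¹). -/
lemma principal_gauge_sub_one {Δ : Mat m n Fun} (hΔ : IsGauge Δ) :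
    MSupp (Set.Ici 1) (principal (Δ.map ofFun) - 1) := by
  obtain ⟨D, rfl, h1, h2⟩ := hΔ
  intro a b
  rw [Matrix.sub_apply, principal_apply, Matrix.map_apply, subst_ofFun]
  rcases a with a | a <;> rcases b with b | b
  · rw [fromBlocks_apply₁₁]
    have : lamPow (-pos (Sum.inl a : Idx m n)) * ofFun ((1 : Matrix _ _ Fun) a b) *
        lamPow (pos (Sum.inl b : Idx m n)) - (1 : Mat m n LFun) (Sum.inl a) (Sum.inl b) = 0 := by
      rw [mul_right_comm, lamPow_mul]
      simp only [pos, neg_add_cancel, lamPow_zero, one_mul, Matrix.one_apply, Sum.inl.injEq]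
      split_ifs <;> simp
    rw [this]
    exact SuppIn.zero
  · simpa using SuppIn.zero
  · simpa using SuppIn.zero
  · rw [fromBlocks_apply₂₂]
    rcases lt_trichotomy a b with hab | hab | hab
    · rw [Matrix.one_apply_ne (by simpa using hab.ne), sub_zero, mul_right_comm, lamPow_mul]
      refine SuppIn.mul (suppIn_lamPow _) (s' := {0}) ?_ ?_
      · rw [← ofSeries_C]
        intro α e he
        rw [ofSeries_C, ofFun, MvPowerSeries.coeff_map, HahnSeries.C_apply,
          HahnSeries.coeff_single, if_neg (by simpa using he)]
      · rintro i rfl j rfl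
        simp only [pos, add_zero, Set.mem_Ici]
        have : (a : ℕ) < b := hab
        omega
    · subst hab
      rw [h1, map_one, mul_one, lamPow_mul, neg_add_cancel, lamPow_zero, Matrix.one_apply_eq,
        sub_self]
      exact SuppIn.zero
    · rw [h2 a b hab, map_zero, mul_zero, zero_mul, Matrix.one_apply_ne (by simpa using hab.ne'),
        sub_zero]
      exact SuppIn.zero

/-- λ⁻¹ becomes z^(-(2n+1)), and the conjugation gives back at most 2n powers of z. -/
lemma principal_mSupp {A : Mat m n LFun} (h : MSupp (Set.Ici 1) A) :
    MSupp (Set.Ici 1) (principal A) := by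
  intro a b
  rw [principal_apply]
  refine SuppIn.mul (SuppIn.mul (suppIn_lamPow _) (h a b).subst
    (t := Set.Ici 1) ?_) (suppIn_lamPow _) ?_
  · rintro i rfl j hj
    have := pos_le a
    simp only [Set.mem_Ici] at hj ⊢
    omega
  · rintro i hi j rfl
    simp only [Set.mem_Ici] at hi ⊢
    omega

lemma mSupp_ofFun (A : Mat m n Fun) : MSupp {0} (A.map ofFun) := fun a b α e he => by
  rw [Matrix.map_apply, ofFun, MvPowerSeries.coeff_map, HahnSeries.C_apply,
    HahnSeries.coeff_single, if_neg (by simpa using he)]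

lemma InMinus.mSupp_gauge_mul_sub {M : Mat m n LFun} (hM : InMinus M) (Δ : Mat m n Fun) :
    MSupp (Set.Ici 1) (Δ.map ofFun * M - Δ.map ofFun) := by
  have : Δ.map ofFun * M - Δ.map ofFun = Δ.map ofFun * (M - 1) := by rw [mul_sub, mul_one]
  rw [this]
  refine (mSupp_ofFun Δ).mul hM.mSupp_sub_one ?_
  rintro i rfl j hj
  simpa using hj

lemma map_toSeries {A : Mat m n LFun} (h : MSupp (Set.Ici 0) A) :
    ofSeries.mapMatrix (A.map toSeries) = A := by
  ext1 a b
  exact ofSeries_toSeries (h a b)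

/-- An invertible loop matrix `c + O(λ⁻¹)` with `c` invertible, and its inverse, as matrices of
power series in `λ⁻¹`. -/
lemma exists_series_inverse {H g : Mat m n LFun} {c : Mat m n Fun} (hg : H * g = 1)
    (hc : IsUnit c.det) (h : MSupp (Set.Ici 1) (H - c.map ofFun)) :
    ∃ η η' : Mat m n (PowerSeries Fun), ofSeries.mapMatrix η = H ∧ ofSeries.mapMatrix η' = g ∧
      η * η' = 1 ∧ η' * η = 1 ∧ η.map PowerSeries.constantCoeff = c := by
  have hs0 : MSupp (Set.Ici 0) H := by
    have := (h.mono (Set.Ici_subset_Ici.2 zero_le_one)).add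
      ((mSupp_ofFun c).mono (t := Set.Ici 0) (by simp))
    rwa [sub_add_cancel] at this
  have hη := map_toSeries hs0
  have hη0 : (H.map toSeries).map PowerSeries.constantCoeff = c := by
    ext1 a b
    rw [Matrix.map_apply, ← PowerSeries.coeff_zero_eq_constantCoeff_apply, ← sub_eq_zero,
      ← PowerSeries.coeff_zero_C (c a b), ← map_sub, ← coeffLam_ofSeries, map_sub, ofSeries_C,
      Matrix.map_apply, ofSeries_toSeries (hs0 a b)]
    exact coeffLam_eq_zero (h a b) (by simp)
  have hηη := Matrix.mul_nonsing_inv _ (isUnit_det_of_constantCoeff hc hη0)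
  have hηη' : (H.map toSeries)⁻¹ * H.map toSeries = 1 := mul_eq_one_comm.1 hηη
  refine ⟨_, _, hη, ?_, hηη, hηη', hη0⟩
  refine left_inv_eq_right_inv (a := H) ?_ hg
  rw [← hη, ← map_mul]
  rw [hη, hηη', map_one]

variable {f : Mat m n (LaurentSeries ℂ)} {M E : Mat m n LFun} {τ : Fun} {v : Fields m n}

/-- The resolvent `S(u, λ)`, normalized to a power series in `z⁻¹`. -/
theorem IsTau.exists_principal (h : IsTau f M E τ) (hv : IsAttached M v) :
    ∃ σ : Mat m n (PowerSeries Fun), DvdX 1 (σ - cyc m n _) ∧ σ ^ (2 * n + 1 + 1) = σ ∧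
      (PowerSeries.X : PowerSeries Fun) • σ.map (coeffwise (dt 0)) +
        ((cyc m n _ + scaled v.toMat) * σ - σ * (cyc m n _ + scaled v.toMat)) = 0 ∧
      ∀ k, logTau₂ τ 0 k =
        PowerSeries.coeff (2 * k + 2) ((σ ^ (2 * k + 1)) (.inr (Fin.last _)) (.inr 0)) := by
  obtain ⟨Δ, g, hΔ, hg, hx, htau⟩ := h.exists_dressing hv
  obtain ⟨H, hH⟩ : ∃ H : Mat m n LFun, H = Δ.map ofFun * M := ⟨_, rfl⟩
  rw [← hH] at hg hx
  simp only [← hH] at htau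
  have hgh : g * H = 1 := mul_eq_one_comm.1 hg
  have hs1 : MSupp (Set.Ici 1) (principal H - 1) := by
    have e : principal H - 1 = (principal (Δ.map ofFun) - 1) +
        principal (H - Δ.map ofFun) := by rw [map_sub]; abel
    rw [e, hH]
    exact (principal_gauge_sub_one hΔ).add (principal_mSupp (h.M_mem.mSupp_gauge_mul_sub Δ))
  have hpg : principal H * principal g = 1 := by rw [← map_mul, hg, map_one]
  obtain ⟨η, η', hηH, hginv, hηη, hηη', hη0⟩ := exists_series_inverse (c := 1) hpg (by simp)
    (by rwa [show ((1 : Mat m n Fun).map ofFun) = 1 from map_one ofFun.mapMatrix])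
  have hη1 : DvdX 1 (η - 1) := by
    intro a b
    have := congrFun (congrFun hη0 a) b
    rw [Matrix.map_apply] at this
    rw [pow_one, PowerSeries.X_dvd_iff, Matrix.sub_apply, map_sub, this, Matrix.one_apply,
      Matrix.one_apply]
    split_ifs <;> simp
  set Λ := cyc m n (PowerSeries Fun) with hΛ
  have hΛL : ofSeries.mapMatrix Λ = cyc m n LFun := map_cyc _
  set σ := η * Λ * η' with hσ
  have hpow : ∀ k, σ ^ k = η * Λ ^ k * η' := by
    intro k
    induction k with
    | zero => rw [pow_zero, pow_zero, mul_one, hηη]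
    | succ k ih =>
      rw [pow_succ, ih, hσ, pow_succ]
      calc η * Λ ^ k * η' * (η * Λ * η') = η * Λ ^ k * (η' * η) * Λ * η' := by
            simp only [mul_assoc]
        _ = _ := by rw [hηη', mul_one]; simp only [mul_assoc]
  have hprin : ∀ k : ℕ, principal (H * JL m n ^ k * g) =
      lamPow (-k) • ofSeries.mapMatrix (σ ^ k) := by
    intro k
    have e1 : principal (H * JL m n ^ k * g) =
        principal H * principal (JL m n) ^ k * principal g := by rw [map_mul, map_mul, map_pow]
    have e2 : ofSeries.mapMatrix (σ ^ k) = principal H * cyc m n LFun ^ k * principal g := by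
      rw [hpow, map_mul, map_mul, map_pow, hηH, hginv, hΛL]
    rw [e1, e2, principal_JL, show (-k : ℤ) = k * -1 by ring, ← lamPow_pow]
    exact mul_smul_pow_mul _ _ _ _ _
  refine ⟨σ, ?_, ?_, ?_, ?_⟩
  · have e : σ - Λ = ((η - 1) * Λ - Λ * (η - 1)) * η' := by
      have : ((η - 1) * Λ - Λ * (η - 1)) * η' = η * Λ * η' - Λ * (η * η') := by noncomm_ring
      rw [this, hηη, mul_one]
    rw [e]
    exact ((hη1.mul_right _).sub (hη1.mul_left _)).mul_right _
  · rw [hpow, hΛ, cyc_pow_card_succ]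
  · refine mapMatrix_ofSeries_injective ?_
    have hS := map_dtL_dressing (V := JL m n + v.toMat.map ofFun) (Q := JL m n) hg hx rfl
      (by ext1 a b; exact dtL_ofLoop _ _)
    have hS' := congrArg principal hS
    have hp1 := hprin 1
    rw [pow_one, pow_one] at hp1
    rw [principal_map_dtL, map_sub, map_mul principal (H * JL m n * g),
      map_mul principal (JL m n + _) (H * JL m n * g), hp1] at hS'
    have hyz : lamPow 1 * lamPow (-1) = 1 := by rw [lamPow_mul, add_neg_cancel, lamPow_zero]
    have hW : lamPow 1 • principal (JL m n + v.toMat.map ofFun) =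
        ofSeries.mapMatrix (Λ + scaled v.toMat) := by
      rw [map_add, map_add, hΛL]
      exact smul_add_of_mul_eq_one hyz principal_JL
        (principal_ofFun (by rw [toMat_eq]; exact posUpper_potential _ _ _))
    have hmap : (lamPow (-((1 : ℕ) : ℤ)) • ofSeries.mapMatrix σ).map (dtL 0) =
        lamPow (-1) • (ofSeries.mapMatrix σ).map (dtL 0) := by
      ext1 a b
      rw [Matrix.map_apply, Matrix.smul_apply, Matrix.smul_apply, smul_eq_mul, smul_eq_mul,
        dtL_mul, show dtL 0 (lamPow _) = 0 from dtL_ofLoop _ _, zero_mul, zero_add]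
      rfl
    rw [hmap, Nat.cast_one] at hS'
    have hSx : (ofSeries.mapMatrix σ).map (dtL 0) =
        ofSeries.mapMatrix σ * principal (JL m n + v.toMat.map ofFun) -
        principal (JL m n + v.toMat.map ofFun) * ofSeries.mapMatrix σ :=
      smul_commutator_cancel hyz hS'
    exact (mapMatrix_ofSeries_commutator _ _).trans
      ((smul_commutator hW hSx).trans (map_zero _).symm)
  · intro k
    rw [htau]
    have hp := congrFun (congrFun (hprin (2 * k + 1)) (.inr (Fin.last _))) (.inr 0)
    rw [principal_apply, Matrix.smul_apply, smul_eq_mul, RingHom.mapMatrix_apply,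
      Matrix.map_apply] at hp
    ext1 α
    rw [coeff_coeffLam, ← coeff_subst (n := n)]
    have hc := congrArg (fun a => (MvPowerSeries.coeff α a).coeff (1 : ℤ)) hp
    simp only [mul_assoc] at hc
    rw [coeff_lamPow_mul, coeff_lamPow_mul, mul_comm, coeff_lamPow_mul] at hc
    -- The corner entry is multiplied by z^(2n), so λ⁻¹ = z^(-(2n+1)) is found at z⁻¹. As S^(2k+1)
    -- becomes z^(2k+1) σ^(2k+1), this is the coefficient of X^(2k+2).
    have e1 : (1 : ℤ) - -(pos (Sum.inr (Fin.last (2 * n)) : Idx m n) : ℤ) -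
        (pos (Sum.inr 0 : Idx m n) : ℤ) = ((2 * n + 1 : ℕ) : ℤ) * (- -1) := by
      simp [pos]; ring
    have e2 : (1 : ℤ) - -((2 * k + 1 : ℕ) : ℤ) = ((2 * k + 2 : ℕ) : ℤ) := by push_cast; ring
    rw [e1, e2, coeff_ofSeries] at hc
    simpa only [mul_assoc] using hc

end Resolvent

end

end CCKP

namespace CCKP

noncomputable section

/-! ### The second derivative in the directions `t_1`, `t_{2n+1}` -/

section Projection

variable {m n : ℕ}

lemma mul_proj_inr {B : Type} [CommRing B] (A : Mat m n B) (a : Idx m n) (b : Fin (2 * n + 1)) :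
    (A * proj m n B : Mat m n B) a (.inr b) = A a (.inr b) := by
  simp [proj, Matrix.mul_apply, Fintype.sum_sum_type, Matrix.one_apply]

lemma mul_proj_inl {B : Type} [CommRing B] (A : Mat m n B) (a : Idx m n) (b : Fin m ⊕ Fin m) :
    (A * proj m n B : Mat m n B) a (.inl b) = 0 := by
  rw [Matrix.mul_apply, Fintype.sum_sum_type]
  simp [proj]

lemma proj_mul_inr {B : Type} [CommRing B] (A : Mat m n B) (a : Fin (2 * n + 1)) (b : Idx m n) :
    (proj m n B * A : Mat m n B) (.inr a) b = A (.inr a) b := by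
  simp [proj, Matrix.mul_apply, Fintype.sum_sum_type, Matrix.one_apply]

lemma proj_mul_inl {B : Type} [CommRing B] (A : Mat m n B) (a : Fin m ⊕ Fin m) (b : Idx m n) :
    (proj m n B * A : Mat m n B) (.inl a) b = 0 := by
  rw [Matrix.mul_apply, Fintype.sum_sum_type]
  simp [proj]

lemma proj_mul_proj {B : Type} [CommRing B] : proj m n B * proj m n B = proj m n B := by
  rw [proj, Matrix.fromBlocks_multiply]; simp

lemma map_coeff_one_mul {I B : Type*} [Fintype I] [CommRing B] (S T : Matrix I I (PowerSeries B)) :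
    (S * T).map (PowerSeries.coeff 1) = S.map (PowerSeries.coeff 0) * T.map (PowerSeries.coeff 1) +
      S.map (PowerSeries.coeff 1) * T.map (PowerSeries.coeff 0) := by
  ext1 a b
  simp [Matrix.mul_apply, PowerSeries.coeff_mul, Finset.Nat.antidiagonal_succ,
    Finset.sum_add_distrib]

lemma map_coeff_two_mul {I B : Type*} [Fintype I] [CommRing B] (S T : Matrix I I (PowerSeries B)) :
    (S * T).map (PowerSeries.coeff 2) = S.map (PowerSeries.coeff 0) * T.map (PowerSeries.coeff 2) +
      S.map (PowerSeries.coeff 1) * T.map (PowerSeries.coeff 1) +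
      S.map (PowerSeries.coeff 2) * T.map (PowerSeries.coeff 0) := by
  ext1 a b
  simp [Matrix.mul_apply, PowerSeries.coeff_mul, Finset.Nat.antidiagonal_succ,
    Finset.sum_add_distrib, add_assoc]

/-- The second coefficient of an idempotent that deforms `proj` and commutes with
`X ∂ + e_{1,2n+1} + X A`. -/
lemma coeff_two_idempotent {B : Type} [CommRing B] {D : B → B} (hD0 : D 0 = 0) (hD1 : D 1 = 0)
    {T W : Mat m n (PowerSeries B)} {A : Mat m n B} (hT : T * T = T)
    (hT0 : T.map (PowerSeries.coeff 0) = proj m n B)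
    (hW0 : W.map (PowerSeries.coeff 0) = single (.inr 0) (.inr (Fin.last _)) 1)
    (hW1 : W.map (PowerSeries.coeff 1) = A)
    (hODE : (PowerSeries.X : PowerSeries B) • T.map (coeffwise D) + (W * T - T * W) = 0) :
    PowerSeries.coeff 2 (T (.inr (Fin.last _)) (.inr 0)) =
      -∑ i, A (.inr 0) (.inl i) * A (.inl i) (.inr (Fin.last _)) := by
  set T₁ := T.map (PowerSeries.coeff 1) with hT₁
  set T₂ := T.map (PowerSeries.coeff 2) with hT₂
  have hDT : (proj m n B).map D = 0 := by
    ext1 a b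
    rcases a with a | a <;> rcases b with b | b <;>
      simp only [proj, Matrix.map_apply, fromBlocks_apply₁₁, fromBlocks_apply₁₂,
        fromBlocks_apply₂₁, fromBlocks_apply₂₂, Matrix.zero_apply, hD0, Matrix.one_apply]
    split_ifs <;> assumption
  -- First order in X of the differential equation; its derivative term sees only the constant
  -- matrix T₀ = `proj`.
  have h1 : W.map (PowerSeries.coeff 0) * T₁ + W.map (PowerSeries.coeff 1) * proj m n B =
      proj m n B * W.map (PowerSeries.coeff 1) + T₁ * W.map (PowerSeries.coeff 0) := by
    rw [← hT0, hT₁, ← map_coeff_one_mul, ← map_coeff_one_mul]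
    ext1 a b
    have := congrArg (PowerSeries.coeff 1) (congrFun (congrFun hODE a) b)
    rw [Matrix.add_apply, map_add, Matrix.sub_apply, map_sub, Matrix.smul_apply, smul_eq_mul,
      PowerSeries.coeff_succ_X_mul, Matrix.map_apply, coeff_coeffwise] at this
    have e : D (PowerSeries.coeff 0 (T a b)) = 0 := by
      have h0 : PowerSeries.coeff 0 (T a b) = proj m n B a b := by rw [← hT0]; rfl
      rw [h0]
      exact congrFun (congrFun hDT a) b
    rw [e, zero_add, Matrix.zero_apply, map_zero, sub_eq_zero] at this
    exact this
  rw [hW0, hW1] at h1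
  have hcol : ∀ i, T₁ (.inl i) (.inr 0) = A (.inl i) (.inr (Fin.last _)) := by
    intro i
    have := congrFun (congrFun h1 (.inl i)) (.inr (Fin.last _))
    rw [Matrix.add_apply, Matrix.add_apply, single_mul_apply_of_ne _ _ _ _ _ (by simp),
      mul_proj_inr, proj_mul_inl, mul_single_apply_same, mul_one, zero_add, zero_add] at this
    exact this.symm
  have hrow : ∀ i, T₁ (.inr (Fin.last _)) (.inl i) = A (.inr 0) (.inl i) := by
    intro i
    have := congrFun (congrFun h1 (.inr 0)) (.inl i)
    rw [Matrix.add_apply, Matrix.add_apply, mul_single_apply_of_ne _ _ _ _ _ (by simp),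
      mul_proj_inl, proj_mul_inr, single_mul_apply_same, one_mul, add_zero, add_zero] at this
    exact this
  have hI1 : T₁ = proj m n B * T₁ + T₁ * proj m n B := by
    rw [← hT0, hT₁, ← map_coeff_one_mul, hT]
  have hI2 : T₂ = proj m n B * T₂ + T₁ * T₁ + T₂ * proj m n B := by
    rw [← hT0, hT₁, hT₂, ← map_coeff_two_mul, hT]
  -- On the second block `proj` is the identity from both sides, so T₁ = 2 T₁ there. At second order
  -- the same reasoning gives T₂ = -T₁ T₁.
  have hblock : ∀ a b, T₁ (.inr a) (.inr b) = 0 := by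
    intro a b
    have := congrFun (congrFun hI1 (.inr a)) (.inr b)
    rw [Matrix.add_apply, proj_mul_inr, mul_proj_inr] at this
    simpa using this
  have h2 := congrFun (congrFun hI2 (.inr (Fin.last _))) (.inr 0)
  rw [Matrix.add_apply, Matrix.add_apply, proj_mul_inr, mul_proj_inr, Matrix.mul_apply,
    Fintype.sum_sum_type] at h2
  simp only [hblock, hcol, hrow, mul_zero, Finset.sum_const_zero, add_zero] at h2
  change T₂ (.inr (Fin.last _)) (.inr 0) = _
  linear_combination -h2

lemma potential_inl_inl_last {B : Type} [CommRing B] (q r : Fin m → B) (u : Fin n → B) (i : Fin m) :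
    potential q r u (.inl (.inl i)) (.inr (Fin.last _)) = q i := by
  simp [potential, genMu, genNu, genOmega, Matrix.sum_apply, Matrix.single_apply]

lemma potential_inl_inr_last {B : Type} [CommRing B] (q r : Fin m → B) (u : Fin n → B) (i : Fin m) :
    potential q r u (.inl (.inr i)) (.inr (Fin.last _)) = (-1) ^ n * r i.rev := by
  simp [potential, genMu, genNu, genOmega, Matrix.sum_apply, Matrix.single_apply, mul_comm]

lemma potential_zero_inl_inl {B : Type} [CommRing B] (q r : Fin m → B) (u : Fin n → B) (i : Fin m) :
    potential q r u (.inr 0) (.inl (.inl i)) = -r i := by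
  simp [potential, genMu, genNu, genOmega, Matrix.sum_apply, Matrix.single_apply, Fin.rev_eq_iff]

lemma potential_zero_inl_inr {B : Type} [CommRing B] (q r : Fin m → B) (u : Fin n → B) (i : Fin m) :
    potential q r u (.inr 0) (.inl (.inr i)) = (-1) ^ (n + 1) * q i.rev := by
  simp [potential, genMu, genNu, genOmega, Matrix.sum_apply, Matrix.single_apply, Fin.rev_eq_iff,
    mul_comm]

/-- The two halves of the first block contribute equally after reversing the index, hence the factor
2. -/
lemma sum_potential {B : Type} [CommRing B] (q r : Fin m → B) (u : Fin n → B) :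
    -∑ i, potential q r u (.inr 0) (.inl i) * potential q r u (.inl i) (.inr (Fin.last _)) =
      2 * ∑ i, q i * r i := by
  rw [Fintype.sum_sum_type]
  simp only [potential_inl_inl_last, potential_inl_inr_last, potential_zero_inl_inl,
    potential_zero_inl_inr]
  have h : ∑ i : Fin m, (-1 : B) ^ (n + 1) * q i.rev * ((-1) ^ n * r i.rev) =
      -∑ i, q i * r i := by
    rw [← Finset.sum_neg_distrib, ← Equiv.sum_comp Fin.revPerm]
    refine Finset.sum_congr rfl fun i _ => ?_
    have h1 : ((-1 : B) ^ n) * (-1) ^ n = 1 := by rw [← mul_pow]; simp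
    simp only [Fin.revPerm_apply, Fin.rev_rev]
    rw [pow_succ]
    linear_combination (-q i * r i) * h1
  rw [h, ← Finset.sum_neg_distrib, ← Finset.sum_add_distrib, ← Finset.sum_neg_distrib,
    Finset.mul_sum]
  refine Finset.sum_congr rfl fun i _ => ?_
  ring

lemma principal_injective : Function.Injective (principal (m := m) (n := n)) := by
  intro A A' h
  ext1 a b
  have := congrFun (congrFun h a) b
  rw [principal_apply, principal_apply] at this
  have h1 : ∀ (c : LFun), lamPow (pos a) * (lamPow (-pos a) * c * lamPow (pos b)) *
      lamPow (-pos b) = c := by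
    intro c
    have e1 : lamPow (pos a) * lamPow (-pos a) = 1 := by
      rw [lamPow_mul, add_neg_cancel, lamPow_zero]
    have e2 : lamPow (pos b) * lamPow (-pos b) = 1 := by
      rw [lamPow_mul, add_neg_cancel, lamPow_zero]
    calc _ = (lamPow (pos a) * lamPow (-pos a)) * c * (lamPow (pos b) * lamPow (-pos b)) := by ring
      _ = c := by rw [e1, e2, one_mul, mul_one]
  refine subst_injective (n := n) ?_
  rw [← h1 (subst n (A a b)), this, h1]

lemma smul_pow_matrix {I R : Type*} [Fintype I] [DecidableEq I] [CommRing R] (c : R)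
    (a : Matrix I I R) (k : ℕ) : (c • a) ^ k = c ^ k • a ^ k := smul_pow _ _ _

/-- Read off from the cyclic matrix in the principal picture, where (zΛ)^N = z^N `proj`. -/
lemma JL_pow_card : JL m n ^ (2 * n + 1) = lamPow (-1) • proj m n LFun := by
  refine principal_injective ?_
  rw [map_pow, principal_JL]
  refine (smul_pow_matrix _ _ _).trans ?_
  rw [cyc_pow_card, lamPow_pow]
  ext1 a b
  rw [principal_apply, Matrix.smul_apply, Matrix.smul_apply, smul_eq_mul, smul_eq_mul, map_mul,
    subst_lamPow]
  by_cases hab : (∃ c, a = .inr c ∧ b = .inr c)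
  · obtain ⟨c, rfl, rfl⟩ := hab
    have e : proj m n LFun (.inr c) (.inr c) = 1 := by simp [proj]
    rw [e, map_one, mul_one, lamPow_mul, lamPow_mul]
    congr 1
    ring
  · have e : proj m n LFun a b = 0 := by
      rcases a with a | a <;> rcases b with b | b <;> simp [proj, Matrix.one_apply]
      rintro rfl
      exact hab ⟨a, rfl, rfl⟩
    rw [e, map_zero, mul_zero, mul_zero, zero_mul]

lemma JL_mul_proj : JL m n * proj m n LFun = proj m n LFun * JL m n := by
  ext1 a b
  rcases a with a | a <;> rcases b with b | b
  · rw [mul_proj_inl, proj_mul_inl]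
  · rw [mul_proj_inr, proj_mul_inl, JL_eq]
    simp [bMat]
  · rw [mul_proj_inl, proj_mul_inr, JL_eq]
    simp [bMat]
  · rw [mul_proj_inr, proj_mul_inr]

lemma ofSeries_connection (A : Mat m n Fun) :
    ofSeries.mapMatrix (single (.inr 0) (.inr (Fin.last _)) 1 +
      (PowerSeries.X : PowerSeries Fun) • (bMat m n Fun + A).map PowerSeries.C) =
    lamPow 1 • (JL m n + A.map ofFun) := by
  have hyz : lamPow 1 * lamPow (-1) = 1 := by rw [lamPow_mul, add_neg_cancel, lamPow_zero]
  ext1 a b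
  rw [JL_eq, RingHom.mapMatrix_apply, Matrix.map_apply, Matrix.add_apply, Matrix.smul_apply,
    Matrix.smul_apply, Matrix.add_apply, Matrix.add_apply, Matrix.map_apply, Matrix.map_apply,
    Matrix.add_apply, smul_eq_mul, smul_eq_mul, map_add, map_mul, map_add PowerSeries.C, map_add,
    ofSeries_C, ofSeries_C, ofSeries_X, mul_add, mul_add, mul_add]
  have e1 : ofFun (bMat m n Fun a b) = bMat m n LFun a b := by
    rcases a with a | a <;> rcases b with b | b <;>
      simp [bMat, Matrix.sum_apply, Matrix.single_apply]
  have e2 : ofSeries ((single (.inr 0) (.inr (Fin.last _)) 1 : Mat m n (PowerSeries Fun)) a b) =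
      lamPow 1 * (single (.inr 0) (.inr (Fin.last _)) (lamPow (-1)) : Mat m n LFun) a b := by
    rw [Matrix.single_apply, Matrix.single_apply, apply_ite ofSeries, mul_ite, hyz, map_one,
      map_zero, mul_zero]
  rw [e1, e2, add_assoc]

lemma mul_smul_mul {I R : Type*} [Fintype I] [CommRing R] (c : R) (x a y : Matrix I I R) :
    x * (c • a) * y = c • (x * a * y) := by
  rw [mul_smul_comm, smul_mul_assoc]

lemma map_proj {B B' : Type} [CommRing B] [CommRing B'] (φ : B →+* B') :
    φ.mapMatrix (proj m n B) = proj m n B' := by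
  ext1 a b
  rcases a with a | a <;> rcases b with b | b <;> simp [proj, Matrix.one_apply, apply_ite φ]

lemma conj_mul_conj {A : Type*} [Ring A] {h g P : A} (hgh : g * h = 1) (hP : P * P = P) :
    h * P * g * (h * P * g) = h * P * g := by
  calc h * P * g * (h * P * g) = h * (P * (g * h) * P) * g := by noncomm_ring
    _ = h * P * g := by rw [hgh, mul_one, hP]

/-- Gauge matrices are block diagonal. The idempotent therefore starts with `proj` even though the
dressing matrix ΔM starts with Δ. -/
lemma IsGauge.conj_proj {Δ Δ' : Mat m n Fun} (hΔ : IsGauge Δ) (h : Δ * Δ' = 1) :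
    Δ * proj m n Fun * Δ' = proj m n Fun := by
  obtain ⟨D, rfl, -, -⟩ := hΔ
  have : fromBlocks 1 0 0 D * proj m n Fun = proj m n Fun * fromBlocks 1 0 0 D := by
    simp [proj, Matrix.fromBlocks_multiply]
  rw [this, Matrix.mul_assoc, h, Matrix.mul_one]

variable {f : Mat m n (LaurentSeries ℂ)} {M E : Mat m n LFun} {τ : Fun} {v : Fields m n}

/-- Here λ⁻¹ itself serves as X. The factor λ in J^N shifts the coefficient of λ⁻¹ to the second
coefficient of the dressed projection. -/
theorem IsTau.logTau_card (h : IsTau f M E τ) (hv : IsAttached M v) :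
    logTau₂ τ 0 n = 2 * ∑ i, v.q i * v.r i := by
  obtain ⟨Δ, g, hΔ, hg, hx, htau⟩ := h.exists_dressing hv
  obtain ⟨χ, χ', hχ, hχ', hχχ, hχχ', hχ0⟩ := exists_series_inverse hg
    (by rw [hΔ.det_eq]; exact isUnit_one) (h.M_mem.mSupp_gauge_mul_sub Δ)
  set T : Mat m n (PowerSeries Fun) := χ * proj m n _ * χ' with hT
  have hTL : ofSeries.mapMatrix T = Δ.map ofFun * M * proj m n LFun * g := by
    rw [hT, map_mul, map_mul, hχ, hχ', map_proj]
  have hS := map_dtL_dressing (V := JL m n + v.toMat.map ofFun) (Q := proj m n LFun) hg hx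
    JL_mul_proj (by
      ext1 a b
      rcases a with a | a <;> rcases b with b | b <;> simp [proj, Matrix.one_apply, dtL]
      split_ifs <;> simp)
  rw [← hTL] at hS
  have hODE := mapMatrix_ofSeries_injective ((mapMatrix_ofSeries_commutator T _).trans
    ((smul_commutator (ofSeries_connection v.toMat).symm hS).trans (map_zero _).symm))
  have hT0 : T.map (PowerSeries.coeff 0) = proj m n Fun := by
    have e : T.map (PowerSeries.coeff 0) =
        (PowerSeries.constantCoeff (R := Fun)).mapMatrix T := by
      ext1 a b; exact PowerSeries.coeff_zero_eq_constantCoeff_apply _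
    have e' : Δ * (PowerSeries.constantCoeff (R := Fun)).mapMatrix χ' = 1 := by
      rw [← hχ0, ← RingHom.mapMatrix_apply, ← map_mul, hχχ, map_one]
    rw [e, hT, map_mul, map_mul, map_proj, RingHom.mapMatrix_apply _ χ, hχ0, hΔ.conj_proj e']
  have h2 := coeff_two_idempotent (A := bMat m n Fun + v.toMat) (D := dt 0) (map_zero _)
    (by rw [dt]; simp) (conj_mul_conj hχχ' proj_mul_proj) hT0
    (by
      ext1 a b
      rw [Matrix.map_apply, Matrix.add_apply, Matrix.smul_apply, map_add, smul_eq_mul,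
        PowerSeries.coeff_zero_X_mul, add_zero, Matrix.single_apply, Matrix.single_apply]
      split_ifs <;> simp)
    (by
      ext1 a b
      rw [Matrix.map_apply, Matrix.add_apply, Matrix.smul_apply, map_add, smul_eq_mul,
        PowerSeries.coeff_succ_X_mul, Matrix.map_apply, PowerSeries.coeff_zero_C,
        Matrix.single_apply]
      split_ifs <;> simp [PowerSeries.coeff_one])
    hODE
  have hb : ∀ i, (bMat m n Fun + v.toMat) (.inr 0) (.inl i) *
      (bMat m n Fun + v.toMat) (.inl i) (.inr (Fin.last _)) =
      v.toMat (.inr 0) (.inl i) * v.toMat (.inl i) (.inr (Fin.last _)) := by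
    intro i
    simp [bMat]
  rw [Finset.sum_congr rfl fun i _ => hb i, toMat_eq, sum_potential] at h2
  rw [htau, ← h2, JL_pow_card]
  have e := mul_smul_mul (lamPow (-1)) (Δ.map ofFun * M) (proj m n LFun) g
  rw [← hTL] at e
  rw [show (Δ.map ofFun * M * (lamPow (-1) • proj m n LFun) * g) = _ from e, Matrix.smul_apply,
    smul_eq_mul]
  ext1 α
  rw [coeff_coeffLam, coeff_lamPow_mul]
  exact coeff_ofSeries _ _ 2

end Projection

end

end CCKP

namespace CCKP

noncomputable section

/-! ### Values of differential polynomials -/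

section Evaluation

variable {m n : ℕ}

lemma aeval_dPoly (v : Fields m n) (P : MvPolynomial (Letter m n) ℂ) :
    MvPolynomial.aeval (Letter.val v) (dPoly P) =
      dt 0 (MvPolynomial.aeval (Letter.val v) P) := by
  induction P using MvPolynomial.induction_on with
  | C c => rw [← MvPolynomial.algebraMap_eq, Derivation.map_algebraMap, map_zero,
      AlgHom.commutes, dt, Derivation.map_algebraMap]
  | add p q hp hq => rw [map_add, map_add, map_add, hp, hq, dt, dt, dt, map_add]
  | mul_X p l hp =>
    rw [Derivation.leibniz, map_add, map_mul, smul_eq_mul, smul_eq_mul, map_mul, map_mul, hp,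
      dPoly_X, MvPolynomial.aeval_X, MvPolynomial.aeval_X, dt, dt, Derivation.leibniz, smul_eq_mul,
      smul_eq_mul]
    congr 2
    cases l <;> exact Function.iterate_succ_apply' _ _ _

lemma aeval_genericPotential (v : Fields m n) :
    (MvPolynomial.aeval (R := ℂ) (Letter.val v)).toRingHom.mapMatrix (genericPotential m n) =
      v.toMat := by
  rw [genericPotential, map_potential, toMat_eq]
  congr 1 <;> funext i <;> exact MvPolynomial.aeval_X _ _

variable {f : Mat m n (LaurentSeries ℂ)} {M E : Mat m n LFun} {τ : Fun} {v : Fields m n}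

/-- The second logarithmic derivatives of the tau function are universal differential
polynomials. -/
theorem IsTau.logTau_eq (h : IsTau f M E τ) (hv : IsAttached M v) (k : ℕ) :
    logTau₂ τ 0 k = evalDiff v (tauPoly m n k) := by
  obtain ⟨σ, h₀, hσ, hD, htau⟩ := h.exists_principal hv
  rw [htau, evalDiff]
  refine (map_tauPoly (D := dt 0) _ (aeval_dPoly v) h₀ hσ ?_ k).symm
  rw [aeval_genericPotential]
  exact hD

/-- `2 ∑ q_i r_i`. -/
def pairingPoly (m n : ℕ) : MvPolynomial (Letter m n) ℂ :=
  MvPolynomial.C 2 * ∑ i, MvPolynomial.X (.q i 0) * MvPolynomial.X (.r i 0)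

lemma evalDiff_pairingPoly (v : Fields m n) :
    evalDiff v (pairingPoly m n) = 2 * ∑ i, v.q i * v.r i := by
  simp only [evalDiff, pairingPoly, map_mul, map_sum, MvPolynomial.aeval_X, Letter.val,
    Function.iterate_zero, id_eq]
  congr 1
  exact map_ofNat (MvPolynomial.aeval (R := ℂ) (Letter.val v)) 2

lemma mem_vars_pairingPoly {l : Letter m n} (hl : l ∈ (pairingPoly m n).vars) :
    ∃ i, l = .q i 0 ∨ l = .r i 0 := by
  classical
  rw [pairingPoly] at hl
  have h1 := MvPolynomial.vars_mul _ _ hl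
  rw [MvPolynomial.vars_C, Finset.empty_union] at h1
  obtain ⟨i, -, hi⟩ := Finset.mem_biUnion.1 (MvPolynomial.vars_sum_subset _ _ h1)
  have h2 := MvPolynomial.vars_mul _ _ hi
  rw [MvPolynomial.vars_X, MvPolynomial.vars_X] at h2
  exact ⟨i, by simpa using h2⟩

end Evaluation

end

end CCKP

theorem mainTheorem6 (m n : ℕ) :
    ∃ (R : Fin n → MvPolynomial (CCKP.Letter m n) ℂ) (K : ℕ → MvPolynomial (CCKP.Letter m n) ℂ),
      (∀ j : Fin n, CCKP.InvolvesOnlyULt (j : ℕ) (R j)) ∧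
      (∀ j : ℕ, CCKP.QROrderLE (2 * j) (K j)) ∧
      CCKP.InvolvesNoU (K 0) ∧
      ∀ (f : CCKP.Mat m n (LaurentSeries ℂ)) (M E : CCKP.Mat m n CCKP.LFun) (τ : CCKP.Fun)
        (v : CCKP.Fields m n),
        CCKP.IsTau f M E τ → CCKP.IsAttached M v → CCKP.IsSolution v →
          (∀ j : Fin n, CCKP.logTau₂ τ 0 j =
            ((2 * (2 * (j : ℂ) + 1)) / (2 * (n : ℂ) + 1)) • v.u j + CCKP.evalDiff v (R j)) ∧
          (∀ j : ℕ, CCKP.logTau₂ τ 0 (n + j) = CCKP.evalDiff v (K j)) := by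
  refine ⟨fun j => CCKP.tauPoly m n j -
      MvPolynomial.C ((2 * (2 * (j : ℂ) + 1)) / (2 * (n : ℂ) + 1)) * MvPolynomial.X (.u j 0),
    -- At j = 0 homogeneity alone would not exclude the u_i, so the explicit 2 ∑ q_i r_i is taken;
    -- it has the same value on attached fields.
    fun j => if j = 0 then CCKP.pairingPoly m n else CCKP.tauPoly m n (n + j), ?_, ?_, ?_, ?_⟩
  · exact fun j => CCKP.involvesOnlyULt_sub (CCKP.isWeightedHomogeneous_tauPoly _)
      (CCKP.coeff_tauPoly j)
  · intro j
    dsimp only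
    split_ifs with hj
    · intro l hl i k hk
      obtain ⟨i', h | h⟩ := CCKP.mem_vars_pairingPoly hl <;> subst h <;> simp at hk <;> omega
    · refine CCKP.qrOrderLE_of_homogeneous ?_
      rw [show 2 * n + 2 + 2 * j = 2 * (n + j) + 2 by ring]
      exact CCKP.isWeightedHomogeneous_tauPoly _
  · intro l hl i k
    dsimp only at hl
    rw [if_pos rfl] at hl
    obtain ⟨i', h | h⟩ := CCKP.mem_vars_pairingPoly hl <;> simp [h]
  · intro f M E τ v hτ hv _
    refine ⟨fun j => ?_, fun j => ?_⟩
    · rw [hτ.logTau_eq hv, CCKP.evalDiff, CCKP.evalDiff, map_sub, map_mul, MvPolynomial.aeval_X,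
        MvPolynomial.aeval_C, Algebra.smul_def]
      exact (add_sub_cancel _ _).symm
    · dsimp only
      split_ifs with hj
      · rw [hj, add_zero, hτ.logTau_card hv, CCKP.evalDiff_pairingPoly]
      · exact hτ.logTau_eq hv _
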